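/- Let $H(x)=\frac{2}{\pi(1+x^2)^2}$, let $\widehat f(\xi)=\int_{\mathbb R} f(x)e^{-ix\xi}\,dx$, and put $$\|f\|_{H^{\ell}}=\Big(\int_{\mathbb R}(1+|\xi|^2)^{\ell}|\widehat f(\xi)|^2\,d\xi\Big)^{1/2},\qquad \|f\|_{L^1(w_k)}=\int_{\mathbb R}|f(x)|(1+|x|)^k\,dx .$$ Consider the one-dimensional inelastic (sticky) Boltzmann equation for Maxwell molecules in self-similar variables, $$\partial_t g(t,x)=-\tfrac14\partial_x\big(x\,g(t,x)\big)+\int_{\mathbb R} g\big(t,x+\tfrac y2\big)g\big(t,x-\tfrac y2\big)\,dy-g(t,x)\int_{\mathbb R} g(t,y)\,dy ,\qquad t\ge 0,\ x\in\mathbb R. \tag{1}$$ A solution of (1) is a family of functions $g(t,\cdot)\ge 0$, $t\ge0$, with $\int_{\mathbb R}(1+|x|)^2g(t,x)\,dx<\infty$, such that for every bounded $\phi\in C^1(\mathbb R)$ with bounded derivative and every $t\ge 0$ $$\frac{d}{dt}\int_{\mathbb R}\phi(x) g(t,x)\,dx=\frac14\int_{\mathbb R} x\phi'(x)g(t,x)\,dx+\iint_{\mathbb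 R^2}\Big(\phi\big(\tfrac{x+y}2\big)-\tfrac12\phi(x)-\tfrac12\phi(y)\Big)g(t,x)g(t,y)\,dx\,dy .$$ **Theorem.** Let $\ell\ge0$, $\beta>0$, $c>0$, $\frac52<k<3$ and $0<\sigma<\frac98-\frac k4-2^{\frac32-k}$. There is a constant $C>0$, depending only on $\ell,k,\sigma,\beta,c$, such that the following holds. Let $g$ be a solution of (1) whose initial datum $g_0=g(0,\cdot)$ satisfies $$\int_{\mathbb R} g_0\,dx=1,\qquad \int_{\mathbb R} x\,g_0\,dx=0,\qquad \int_{\mathbb R} x^2g_0\,dx=1,\qquad g_0\in H^\ell(\mathbb R),\qquad |\widehat{g_0}(\xi)|\le(1+c^2|\xi|^2)^{-\beta/2}\quad(\xi\in\mathbb R).$$ Then for all $t\ge0$ one has $g(t)\in H^\ell(\mathbb R)$ and $$\|g(t)-H\|_{H^\ell}\le e^{-\sigma t}\Big(\|g_0-H\|_{H^\ell}+C\,\|g_0-H\|_{L^1(w_k)}\Big),$$ where the right-hand side is $+\infty$ if $g_0\notin L^1(w_k)$. -/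

import Mathlib

open MeasureTheory Set
open scoped ENNReal

noncomputable section

namespace Boltzmann1D

/-- The steady profile `H(x) = 2 / (π (1 + x²)²)`. -/
def H (x : ℝ) : ℝ := 2 / (Real.pi * (1 + x ^ 2) ^ 2)

/-- The Fourier transform `f̂(ξ) = ∫ f(x) e^{-i x ξ} dx` of an integrable function. -/
def fourier (f : ℝ → ℝ) (ξ : ℝ) : ℂ :=
  ∫ x : ℝ, (f x : ℂ) * Complex.exp (-(Complex.I * x * ξ))

/-- The Sobolev norm `‖f‖_{H^s} = (∫ (1 + |ξ|²)^s |f̂(ξ)|² dξ)^{1/2}`, with values in `[0, ∞]`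
(used below for integrable `f` only). -/
def sobolevNorm (s : ℝ) (f : ℝ → ℝ) : ℝ≥0∞ :=
  (∫⁻ ξ : ℝ, ENNReal.ofReal ((1 + |ξ| ^ 2) ^ s * ‖fourier f ξ‖ ^ 2)) ^ (1 / 2 : ℝ)

/-- `f ∈ H^s(ℝ)`, for integrable `f`. -/
def MemSobolev (s : ℝ) (f : ℝ → ℝ) : Prop :=
  MemLp f 2 volume ∧ sobolevNorm s f < ⊤

/-- The weighted norm `‖f‖_{L¹(w_a)} = ∫ |f(x)| (1 + |x|)^a dx`, with values in `[0, ∞]`. -/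
def weightedL1Norm (a : ℝ) (f : ℝ → ℝ) : ℝ≥0∞ :=
  ∫⁻ x : ℝ, ENNReal.ofReal (|f x| * (1 + |x|) ^ a)

/-- The test functions of class `C_b^1(ℝ)`: bounded, `C¹`, with bounded derivative. -/
def IsTest (φ : ℝ → ℝ) : Prop :=
  ContDiff ℝ 1 φ ∧ ∃ M : ℝ, ∀ x, |φ x| ≤ M ∧ |deriv φ x| ≤ M

/-- `g = g(t, x)`, `t ≥ 0`, is a (weak) solution of the self-similar equation
`∂ₜ g = -(1/4) ∂ₓ(x g) + Q₀(g, g)` for sticky Maxwell particles: each `g(t, ·)` is a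
non-negative density with finite moments up to order two, and the equation holds against every
test function in `C_b^1`. The time derivative at `t = 0` is one-sided. -/
structure IsSolution (g : ℝ → ℝ → ℝ) : Prop where
  nonneg : ∀ t : ℝ, 0 ≤ t → ∀ᵐ x : ℝ, 0 ≤ g t x
  moments : ∀ t : ℝ, 0 ≤ t → Integrable (fun x : ℝ => (1 + |x|) ^ 2 * g t x)
  weak : ∀ φ : ℝ → ℝ, IsTest φ → ∀ t : ℝ, 0 ≤ t →
    HasDerivWithinAt (fun s : ℝ => ∫ x : ℝ, φ x * g s x)
      (1 / 4 * (∫ x : ℝ, x * deriv φ x * g t x)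
        + ∫ p : ℝ × ℝ, (φ ((p.1 + p.2) / 2) - 1 / 2 * φ p.1 - 1 / 2 * φ p.2)
            * (g t p.1 * g t p.2))
      (Ici 0) t

/-- Unit mass, zero momentum and unit energy. -/
def IsNormalised (f : ℝ → ℝ) : Prop :=
  (∫ x : ℝ, f x) = 1 ∧ (∫ x : ℝ, x * f x) = 0 ∧ (∫ x : ℝ, x ^ 2 * f x) = 1

end Boltzmann1D

end

/-!
On the Fourier side the equation reads `∂ₜ ĝ(ξ) = (1/4) ξ ∂_ξ ĝ(ξ) + ĝ(ξ/2)² - ĝ(ξ)` (unit mass), so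
along the characteristics `t ↦ ξ e^{-t/4}` it is an ordinary differential equation,
`∂ₜ [eᵗ ĝ(t, ξ e^{-t/4})] = eᵗ ĝ(t, ξ e^{-t/4} / 2)²` (`IsSolution.hasDerivWithinAt_fourier`). It is
derived from the weak formulation with the test functions `φ(e^{-t/4} x)`, for which the drift
cancels; taking `φ` with compact support first and truncating afterwards, no propagation of moments is
needed. The profile `H` has transform `steady ξ = (1 + |ξ|) e^{-|ξ|}` (`fourier_H`), and
`W = ĝ - steady` satisfies the linear problem with source `N = W (ĝ + steady)`.

All estimates are then pointwise comparisons along characteristics with explicit barriers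
(`IsTransported.norm_le`), each bootstrapped from a crude bound with a remainder `K (L t)ⁿ / n!`:

* `IsTransported.norm_le_barrier`: since `1` and `steady (a ·)` are steady and the gain is convex,
  `d + (1 - d) steady (a ξ)` stays above `|ĝ|`. With `exists_barrier` this makes `|ĝ| + steady` small
  at high frequencies, uniformly in time and in the solution (`exists_uniform_smallness`).
* `IsTransported.norm_le_rpow`: `|W|` decays like `|ξ|^κ e^{-λ t}` with
  `λ = 1 - κ/4 - 2^{1-κ}`. For `κ = k - 1/2` this is `9/8 - k/4 - 2^{3/2-k}`, the rate of the theorem;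
  the initial bound `norm_fourier_sub_H_le` uses that the moments of `g₀ - H` up to order two vanish.
* `IsTransported.norm_le_series`: where the gain is small, `W` is dominated by the transported datum
  `Σ_j e^{-t} (δ t)^j / j! |W₀(ξ e^{t/4} / 2^j)|`, while the low frequencies contribute a source that
  is controlled by the previous bound and dominated by `e^{-σ t} (1 + ξ²)^{-p}`.

Taking weighted `L²` norms of the last bound (`IsTransported.eLpNorm_le`), the series contributes at most
`e^{-(9/8 - δ 2^{l + 1/2}) t} ‖g₀ - H‖`, which is below `e^{-σ t} ‖g₀ - H‖` for small `δ`. That `g(t)` is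
itself square integrable follows from Plancherel's theorem (`memLp_two_of_fourier`).
-/

namespace Boltzmann1D

open Filter Topology

/-! ### The steady profile and its Fourier transform -/

/-- The Fourier transform `(1 + |ξ|) e^{-|ξ|}` of the steady profile `H`, see `fourier_H`. -/
noncomputable def steady (ξ : ℝ) : ℝ := (1 + |ξ|) * Real.exp (-|ξ|)

lemma continuous_steady : Continuous steady := by
  unfold steady; fun_prop

lemma steady_pos (ξ : ℝ) : 0 < steady ξ := by
  unfold steady; positivity

lemma steady_le_one (ξ : ℝ) : steady ξ ≤ 1 := by
  unfold steady
  have h := Real.add_one_le_exp |ξ|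
  rw [Real.exp_neg, ← div_eq_mul_inv, div_le_one (Real.exp_pos _)]
  linarith

lemma steady_abs (ξ : ℝ) : steady |ξ| = steady ξ := by
  simp [steady]

/-- `steady` decays faster than any power, from `yⁿ / n! ≤ e^y` at `y = 1 + |ξ|`. -/
lemma steady_le (p : ℕ) (ξ : ℝ) :
    steady ξ ≤ (Real.exp 1 * (2 * p + 1).factorial) * ((1 + ξ ^ 2) ^ p)⁻¹ := by
  unfold steady
  have h0 : (0 : ℝ) < (2 * p + 1).factorial := by exact_mod_cast Nat.factorial_pos _
  have h1 := Real.pow_div_factorial_le_exp (1 + |ξ|) (by positivity) (2 * p + 1)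
  have h2 : (1 + ξ ^ 2) ^ p ≤ (1 + |ξ|) ^ (2 * p) := by
    rw [pow_mul]
    gcongr
    nlinarith [abs_nonneg ξ, sq_abs ξ]
  rw [div_le_iff₀ h0, Real.exp_add] at h1
  rw [← div_eq_mul_inv, le_div_iff₀ (by positivity), Real.exp_neg]
  rw [mul_assoc, inv_mul_eq_div, mul_div_assoc', div_le_iff₀ (Real.exp_pos _)]
  calc (1 + |ξ|) * (1 + ξ ^ 2) ^ p ≤ (1 + |ξ|) * (1 + |ξ|) ^ (2 * p) := by gcongr
    _ = (1 + |ξ|) ^ (2 * p + 1) := by ring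
    _ ≤ _ := h1
    _ = _ := by ring

lemma integrable_steady : Integrable steady := by
  refine (integrable_inv_one_add_sq.const_mul (Real.exp 1 * (2 * 1 + 1).factorial)).mono'
    continuous_steady.aestronglyMeasurable (ae_of_all _ fun ξ => ?_)
  rw [Real.norm_of_nonneg (steady_pos ξ).le]
  simpa using steady_le 1 ξ

lemma exp_char_norm (x ξ : ℝ) : ‖Complex.exp (-(Complex.I * x * ξ))‖ = 1 := by
  have : -(Complex.I * x * ξ) = ((-(x * ξ) : ℝ) : ℂ) * Complex.I := by push_cast; ring
  rw [this, Complex.norm_exp_ofReal_mul_I]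

lemma integrable_mul_char {f : ℝ → ℝ} (hf : Integrable f) (ξ : ℝ) :
    Integrable (fun x : ℝ => (f x : ℂ) * Complex.exp (-(Complex.I * x * ξ))) := by
  refine hf.ofReal.mul_bdd (c := 1) (Continuous.aestronglyMeasurable (by fun_prop))
    (ae_of_all _ fun x => (exp_char_norm x ξ).le)

lemma norm_fourier_le {f : ℝ → ℝ} (ξ : ℝ) : ‖fourier f ξ‖ ≤ ∫ x, |f x| := by
  refine (norm_integral_le_integral_norm _).trans_eq (integral_congr_ae (ae_of_all _ fun x => ?_))
  simp [exp_char_norm]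

lemma fourier_sub {f h : ℝ → ℝ} (hf : Integrable f) (hh : Integrable h) (ξ : ℝ) :
    fourier (fun x => f x - h x) ξ = fourier f ξ - fourier h ξ := by
  unfold fourier
  rw [← integral_sub (integrable_mul_char hf ξ) (integrable_mul_char hh ξ)]
  congr 1 with x
  push_cast; ring

lemma integral_Ioi_steady (w : ℝ) :
    IntegrableOn (fun x : ℝ => (steady x : ℂ) * Complex.exp (-(Complex.I * x * w))) (Ioi 0) ∧
    ∫ x in Ioi (0 : ℝ), (steady x : ℂ) * Complex.exp (-(Complex.I * x * w))
      = 1 / (1 + Complex.I * w) + 1 / (1 + Complex.I * w) ^ 2 := by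
  have hint := (integrable_mul_char integrable_steady w).integrableOn (s := Ioi 0)
  refine ⟨hint, ?_⟩
  set a : ℂ := 1 + Complex.I * w with ha
  have ha0 : a ≠ 0 := fun h => by
    have := congrArg Complex.re h
    simp [ha] at this
  have heq : ∀ x ∈ Ioi (0 : ℝ), (steady x : ℂ) * Complex.exp (-(Complex.I * x * w))
      = (1 + x) * Complex.exp (-(a * x)) := by
    intro x hx
    have hx' : |x| = x := abs_of_pos hx
    simp only [steady, hx']
    push_cast
    rw [mul_assoc, ← Complex.exp_add]
    congr 2
    simp only [ha]; ring
  rw [setIntegral_congr_fun measurableSet_Ioi heq]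
  rw [integrableOn_congr_fun heq measurableSet_Ioi] at hint
  have hder : ∀ x ∈ Ici (0 : ℝ), HasDerivAt
      (fun x : ℝ => -((1 + (x : ℂ)) / a + 1 / a ^ 2) * Complex.exp (-(a * x)))
      ((1 + x) * Complex.exp (-(a * x))) x := by
    intro x _
    have h1 : HasDerivAt (fun x : ℝ => (x : ℂ)) 1 x := Complex.ofRealCLM.hasDerivAt
    have h2 := (((h1.const_add 1).div_const a).add_const (1 / a ^ 2)).neg
    have h3 := ((h1.const_mul a).neg).cexp
    refine (h2.mul h3).congr_deriv ?_
    simp only [Pi.neg_apply]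
    field_simp
    ring
  have hlim : Tendsto (fun x : ℝ => -((1 + (x : ℂ)) / a + 1 / a ^ 2) * Complex.exp (-(a * x)))
      atTop (𝓝 0) := by
    rw [tendsto_zero_iff_norm_tendsto_zero]
    have h0 := Real.tendsto_pow_mul_exp_neg_atTop_nhds_zero 0
    have h1 := Real.tendsto_pow_mul_exp_neg_atTop_nhds_zero 1
    have h2 := ((h0.add h1).mul_const ‖a‖⁻¹).add (h0.mul_const (‖a‖⁻¹ ^ 2))
    simp only [add_zero, zero_mul] at h2
    refine squeeze_zero' (Eventually.of_forall fun x => norm_nonneg _) ?_ h2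
    filter_upwards [eventually_ge_atTop 0] with x hx
    have he : ‖Complex.exp (-(a * x))‖ = Real.exp (-x) := by
      rw [Complex.norm_exp]; simp [ha]
    rw [norm_mul, he, norm_neg]
    have : ‖(1 + (x : ℂ)) / a + 1 / a ^ 2‖ ≤ (1 + x) * ‖a‖⁻¹ + ‖a‖⁻¹ ^ 2 := by
      refine (norm_add_le _ _).trans_eq ?_
      have : ‖(1 + (x : ℂ))‖ = 1 + x := by
        rw [← Complex.ofReal_one, ← Complex.ofReal_add, Complex.norm_real,
          Real.norm_of_nonneg (by positivity)]
      simp [this, div_eq_mul_inv]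
    calc _ ≤ ((1 + x) * ‖a‖⁻¹ + ‖a‖⁻¹ ^ 2) * Real.exp (-x) := by gcongr
      _ = _ := by ring
  rw [integral_Ioi_of_hasDerivAt_of_tendsto' hder hint hlim]
  simp

lemma fourier_steady (w : ℝ) : fourier steady w = ((4 / (1 + w ^ 2) ^ 2 : ℝ) : ℂ) := by
  obtain ⟨-, h2⟩ := integral_Ioi_steady w
  obtain ⟨-, h4⟩ := integral_Ioi_steady (-w)
  have hI := integrable_mul_char integrable_steady w
  have h5 : ∫ x in Iic (0 : ℝ), (steady x : ℂ) * Complex.exp (-(Complex.I * x * w))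
      = ∫ x in Ioi (0 : ℝ), (steady x : ℂ) * Complex.exp (-(Complex.I * x * (-w : ℝ))) := by
    have := integral_comp_neg_Iic (0 : ℝ)
      (fun x : ℝ => (steady x : ℂ) * Complex.exp (-(Complex.I * x * (-w : ℝ))))
    rw [neg_zero] at this
    rw [← this]
    refine setIntegral_congr_fun measurableSet_Iic fun x _ => ?_
    simp [steady]
  unfold fourier
  rw [← intervalIntegral.integral_Iic_add_Ioi hI.integrableOn hI.integrableOn, h5, h4, h2]
  have hp : (1 + Complex.I * w) ≠ 0 := fun h => by
    have := congrArg Complex.re h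
    simp at this
  have hm : (1 - Complex.I * w) ≠ 0 := fun h => by
    have := congrArg Complex.re h
    simp at this
  have hmul : (1 + Complex.I * w) * (1 - Complex.I * w) = 1 + (w : ℂ) ^ 2 := by
    linear_combination (-(w : ℂ) ^ 2) * Complex.I_sq
  push_cast
  rw [← hmul, mul_neg, ← sub_eq_add_neg]
  field_simp
  ring

lemma continuous_H : Continuous H := by
  unfold H
  refine continuous_const.div (by fun_prop) fun x => by positivity

lemma H_nonneg (x : ℝ) : 0 ≤ H x := by unfold H; positivity

lemma H_le (x : ℝ) : (1 + x ^ 2) * H x ≤ (1 + x ^ 2)⁻¹ := by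
  unfold H
  rw [mul_div_assoc', div_le_iff₀ (by positivity)]
  have : (1 + x ^ 2)⁻¹ * (Real.pi * (1 + x ^ 2) ^ 2) = Real.pi * (1 + x ^ 2) := by
    field_simp
  rw [this]
  nlinarith [Real.pi_gt_three, sq_nonneg x]

lemma integrable_sq_mul_H : Integrable (fun x => (1 + x ^ 2) * H x) := by
  refine integrable_inv_one_add_sq.mono'
    (Continuous.aestronglyMeasurable (by have := continuous_H; fun_prop)) (ae_of_all _ fun x => ?_)
  rw [Real.norm_of_nonneg (mul_nonneg (by positivity) (H_nonneg x))]
  exact H_le x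

lemma integrable_H : Integrable H := by
  refine integrable_sq_mul_H.mono' continuous_H.aestronglyMeasurable (ae_of_all _ fun x => ?_)
  rw [Real.norm_of_nonneg (H_nonneg x)]
  nlinarith [H_nonneg x, sq_nonneg x, mul_nonneg (sq_nonneg x) (H_nonneg x)]

/-- Fourier inversion applied to `steady`, whose transform is `2 π H`. -/
lemma fourier_H (ξ : ℝ) : fourier H ξ = (steady ξ : ℂ) := by
  have hpi := Real.pi_pos
  have hF : FourierTransform.fourier (fun x : ℝ => (steady x : ℂ))
      = fun v : ℝ => ((2 * Real.pi * H (2 * Real.pi * v) : ℝ) : ℂ) := by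
    ext v
    rw [Real.fourier_real_eq_integral_exp_smul]
    have := fourier_steady (2 * Real.pi * v)
    unfold fourier at this
    have h2 : 2 * Real.pi * H (2 * Real.pi * v) = 4 / (1 + (2 * Real.pi * v) ^ 2) ^ 2 := by
      unfold H; field_simp; ring
    rw [h2, ← this]
    congr 1 with x
    rw [smul_eq_mul, mul_comm]
    congr 2
    push_cast; ring
  have hint : Integrable (FourierTransform.fourier (fun x : ℝ => (steady x : ℂ))) := by
    rw [hF]
    exact ((integrable_H.comp_mul_left' (by positivity : (2 * Real.pi) ≠ 0)).const_mul _).ofReal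
  have hinv : FourierTransformInv.fourierInv
      (FourierTransform.fourier (fun x : ℝ => (steady x : ℂ))) (-ξ) = (steady (-ξ) : ℂ) :=
    Integrable.fourierInv_fourier_eq integrable_steady.ofReal hint
      (by have := continuous_steady; fun_prop)
  rw [hF, Real.fourierInv_eq'] at hinv
  have hs : steady (-ξ) = steady ξ := by simp [steady]
  simp only [hs] at hinv
  rw [← hinv]
  unfold fourier
  have := Measure.integral_comp_mul_left
    (fun x : ℝ => (H x : ℂ) * Complex.exp (-(Complex.I * x * ξ))) (2 * Real.pi)
  rw [eq_comm, abs_of_pos (by positivity), inv_smul_eq_iff₀ (by positivity)] at this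
  rw [this, ← integral_smul]
  congr 1 with x
  simp only [Complex.real_smul, smul_eq_mul]
  push_cast
  have : (-(Complex.I * (2 * Real.pi * x) * ξ))
    = (2 * Real.pi * (inner ℝ x (-ξ) : ℝ) * Complex.I : ℂ) := by
    simp; ring
  rw [this]; ring

lemma integral_H : ∫ x, H x = 1 := by
  have := fourier_H 0
  simp only [fourier, steady] at this
  simp at this
  rw [integral_complex_ofReal] at this
  exact_mod_cast this

lemma integral_mul_H : ∫ x, x * H x = 0 := by
  have h := integral_neg_eq_self (fun x : ℝ => x * H x) volume
  have h2 : (fun x : ℝ => (-x) * H (-x)) = fun x => -(x * H x) := by ext x; simp [H]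
  simp only [h2, integral_neg] at h
  linarith

lemma integral_sq_mul_H : ∫ x, x ^ 2 * H x = 1 := by
  have h : (fun x : ℝ => x ^ 2 * H x) = fun x => 2 / Real.pi * (1 + x ^ 2)⁻¹ - H x := by
    ext x
    unfold H
    have := Real.pi_pos
    field_simp
    ring
  rw [h, integral_sub (integrable_inv_one_add_sq.const_mul _) integrable_H,
    integral_const_mul, integral_univ_inv_one_add_sq, integral_H]
  have := Real.pi_pos
  field_simp
  norm_num

/-! ### Weak formulation along dilated test functions -/

lemma IsSolution.integrable {g : ℝ → ℝ → ℝ} (hg : IsSolution g) {t : ℝ} (ht : 0 ≤ t) :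
    Integrable (g t) := by
  have h := (hg.moments t ht).bdd_mul (f := fun x : ℝ => ((1 + |x|) ^ 2)⁻¹) (c := 1)
    (Continuous.aestronglyMeasurable
      (Continuous.inv₀ (by fun_prop) fun x => by positivity))
    (ae_of_all _ fun x => by
      rw [Real.norm_of_nonneg (by positivity)]
      exact inv_le_one_of_one_le₀ (by nlinarith [abs_nonneg x]))
  refine h.congr (ae_of_all _ fun x => ?_)
  have : (1 + |x|) ^ 2 ≠ 0 := by positivity
  simp only
  field_simp

lemma isTest_const (c : ℝ) : IsTest (fun _ => c) :=
  ⟨contDiff_const, |c|, fun x => by simp⟩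

lemma isTest_of_hasCompactSupport {φ : ℝ → ℝ} (hφ : ContDiff ℝ 1 φ) (hc : HasCompactSupport φ) :
    IsTest φ := by
  refine ⟨hφ, ?_⟩
  obtain ⟨A, hA⟩ := hc.exists_bound_of_continuous hφ.continuous
  obtain ⟨B, hB⟩ := hc.deriv.exists_bound_of_continuous (hφ.continuous_deriv le_rfl)
  exact ⟨max A B, fun x => ⟨(hA x).trans (le_max_left _ _), (hB x).trans (le_max_right _ _)⟩⟩

/-- A solution with unit initial mass has unit mass at all times. -/
lemma IsSolution.integral_eq_one {g : ℝ → ℝ → ℝ} (hg : IsSolution g) (h0 : ∫ x, g 0 x = 1)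
    {t : ℝ} (ht : 0 ≤ t) : ∫ x, g t x = 1 := by
  have hd : ∀ s, 0 ≤ s → HasDerivWithinAt (fun s => ∫ x, g s x) 0 (Ici 0) s := by
    intro s hs
    have := hg.weak _ (isTest_const 1) s hs
    norm_num at this
    exact this
  rw [← h0]
  refine constant_of_has_deriv_right_zero (f := fun s => ∫ x, g s x) (a := 0) (b := t)
    (fun s hs => ?_) (fun s hs => ?_) t ⟨ht, le_rfl⟩
  · exact ((hd s hs.1).continuousWithinAt).mono Icc_subset_Ici_self
  · exact (hd s hs.1).mono (Ici_subset_Ici.2 hs.1)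

lemma IsSolution.integral_abs {g : ℝ → ℝ → ℝ} (hg : IsSolution g) (h0 : ∫ x, g 0 x = 1)
    {t : ℝ} (ht : 0 ≤ t) : ∫ x, |g t x| = 1 := by
  rw [← hg.integral_eq_one h0 ht]
  refine integral_congr_ae ?_
  filter_upwards [hg.nonneg t ht] with x hx using abs_of_nonneg hx

lemma IsSolution.norm_fourier_le_one {g : ℝ → ℝ → ℝ} (hg : IsSolution g) (h0 : ∫ x, g 0 x = 1)
    {t : ℝ} (ht : 0 ≤ t) (ξ : ℝ) : ‖fourier (g t) ξ‖ ≤ 1 :=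
  (norm_fourier_le ξ).trans_eq (hg.integral_abs h0 ht)

lemma integrable_mul_of_bounded {φ f : ℝ → ℝ} (hφ : Continuous φ) {M : ℝ} (hM : ∀ x, |φ x| ≤ M)
    (hf : Integrable f) : Integrable (fun x => φ x * f x) :=
  hf.bdd_mul (c := M) hφ.aestronglyMeasurable (ae_of_all _ hM)

lemma integrable_prod_of_bounded {φ : ℝ × ℝ → ℝ} {f : ℝ → ℝ} (hφ : Continuous φ) {M : ℝ}
    (hM : ∀ x, |φ x| ≤ M) (hf : Integrable f) :
    Integrable (fun p : ℝ × ℝ => φ p * (f p.1 * f p.2)) :=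
  (hf.mul_prod hf).bdd_mul (c := M) hφ.aestronglyMeasurable (ae_of_all _ hM)

lemma abs_integral_mul_le {φ f : ℝ → ℝ} {M : ℝ} (hM : ∀ x, |φ x| ≤ M) (hf : Integrable f) :
    |∫ x, φ x * f x| ≤ M * ∫ x, |f x| := by
  rw [← integral_const_mul, ← Real.norm_eq_abs]
  refine norm_integral_le_of_norm_le (hf.abs.const_mul M) (ae_of_all _ fun x => ?_)
  rw [norm_mul]
  exact mul_le_mul_of_nonneg_right (hM x) (abs_nonneg _)

/-- The gain term `∬ φ((x + y) / 2) f(x) f(y) dx dy` of the weak collision operator. -/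
noncomputable def gain (f φ : ℝ → ℝ) : ℝ :=
  ∫ p : ℝ × ℝ, φ ((p.1 + p.2) / 2) * (f p.1 * f p.2)

lemma abs_gain_le {φ f : ℝ → ℝ} {M : ℝ} (hM : ∀ x, |φ x| ≤ M) (hf : Integrable f) :
    |gain f φ| ≤ M * (∫ x, |f x|) ^ 2 := by
  have h : (∫ x, |f x|) ^ 2 = ∫ p : ℝ × ℝ, |f p.1| * |f p.2| := by
    rw [sq]; exact (integral_prod_mul _ _).symm
  rw [h, ← integral_const_mul, ← Real.norm_eq_abs]
  refine norm_integral_le_of_norm_le ((hf.abs.mul_prod hf.abs).const_mul M)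
    (ae_of_all _ fun p => ?_)
  rw [norm_mul, norm_mul]
  exact mul_le_mul_of_nonneg_right (hM _) (by positivity)

/-- The weak formulation with the loss term written out for unit mass. -/
lemma IsSolution.weak_gain {g : ℝ → ℝ → ℝ} (hg : IsSolution g) (h0 : ∫ x, g 0 x = 1)
    {φ : ℝ → ℝ} (hφ : IsTest φ) {t : ℝ} (ht : 0 ≤ t) :
    HasDerivWithinAt (fun s : ℝ => ∫ x : ℝ, φ x * g s x)
      (1 / 4 * (∫ x : ℝ, x * deriv φ x * g t x) + gain (g t) φ - ∫ x, φ x * g t x) (Ici 0) t := by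
  refine (hg.weak φ hφ t ht).congr_deriv ?_
  obtain ⟨hφ1, M, hM⟩ := hφ
  have hc := hφ1.continuous
  have hi := hg.integrable ht
  have h1 := integrable_prod_of_bounded (φ := fun p => φ ((p.1 + p.2) / 2)) (by fun_prop)
    (fun p => (hM _).1) hi
  have h2 : ∫ p : ℝ × ℝ, φ p.1 * (g t p.1 * g t p.2) = ∫ x, φ x * g t x := by
    have := integral_prod_mul (μ := volume) (ν := volume) (fun x => φ x * g t x) (g t)
    rw [hg.integral_eq_one h0 ht, mul_one] at this
    rw [← this]
    congr 1 with p
    ring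
  have h3 : ∫ p : ℝ × ℝ, φ p.2 * (g t p.1 * g t p.2) = ∫ x, φ x * g t x := by
    have := integral_prod_mul (μ := volume) (ν := volume) (g t) (fun x => φ x * g t x)
    rw [hg.integral_eq_one h0 ht, one_mul] at this
    rw [← this]
    congr 1 with p
    ring
  have i2 := (integrable_prod_of_bounded (φ := fun p => φ p.1) (by fun_prop)
    (fun p => (hM _).1) hi).const_mul (1 / 2)
  have i3 := (integrable_prod_of_bounded (φ := fun p => φ p.2) (by fun_prop)
    (fun p => (hM _).1) hi).const_mul (1 / 2)
  have h4 : (fun p : ℝ × ℝ => (φ ((p.1 + p.2) / 2) - 1 / 2 * φ p.1 - 1 / 2 * φ p.2)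
      * (g t p.1 * g t p.2)) = fun p => φ ((p.1 + p.2) / 2) * (g t p.1 * g t p.2)
        - 1 / 2 * (φ p.1 * (g t p.1 * g t p.2)) - 1 / 2 * (φ p.2 * (g t p.1 * g t p.2)) := by
    ext p; ring
  have i12 : Integrable (fun p : ℝ × ℝ => φ ((p.1 + p.2) / 2) * (g t p.1 * g t p.2)
      - 1 / 2 * (φ p.1 * (g t p.1 * g t p.2))) := h1.sub i2
  rw [h4, integral_sub i12 i3, integral_sub h1 i2, integral_const_mul, integral_const_mul,
    h2, h3, gain]
  ring

/-- Second-order Taylor expansion of `t ↦ φ (e^{-t/4} x)`, uniform in `x`. -/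
lemma exists_dilation_taylor {φ : ℝ → ℝ} (hφ : ContDiff ℝ 2 φ) (hc : HasCompactSupport φ) :
    ∃ C : ℝ, ∀ a s x : ℝ, |φ (Real.exp (-s / 4) * x) - φ (Real.exp (-a / 4) * x)
      + (s - a) / 4 * (Real.exp (-a / 4) * x * deriv φ (Real.exp (-a / 4) * x))|
        ≤ C * |s - a| ^ 2 := by
  -- `∂ₜ φ (e^{-t/4} x) = -(1/4) (E φ) (e^{-t/4} x)` with the Euler operator `E φ = x φ'`.
  set ψ : ℝ → ℝ := fun x => x * deriv φ x with hψ
  have hφ' : ContDiff ℝ 1 (deriv φ) := (contDiff_succ_iff_deriv.1 hφ).2.2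
  have hψ1 : ContDiff ℝ 1 ψ := contDiff_id.mul hφ'
  have hψc : HasCompactSupport ψ := hc.deriv.mul_left
  obtain ⟨C, hC⟩ := (hψc.deriv.mul_left (f := fun x : ℝ => x)).exists_bound_of_continuous
    (continuous_id.mul (hψ1.continuous_deriv le_rfl))
  have hC0 : 0 ≤ C := (norm_nonneg _).trans (hC 0)
  have hexp : ∀ x s : ℝ, HasDerivAt (fun s => Real.exp (-s / 4) * x)
      (-(1 / 4) * (Real.exp (-s / 4) * x)) s := by
    intro x s
    have := (((hasDerivAt_id s).neg.div_const 4).exp).mul_const x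
    refine this.congr_deriv ?_
    simp only [Pi.neg_apply, id]; ring
  have hd : ∀ f : ℝ → ℝ, ContDiff ℝ 1 f → ∀ x s : ℝ, HasDerivAt (fun s => f (Real.exp (-s / 4) * x))
      (-(1 / 4) * (Real.exp (-s / 4) * x * deriv f (Real.exp (-s / 4) * x))) s := by
    intro f hf x s
    have h1 := ((hf.differentiable one_ne_zero) (Real.exp (-s / 4) * x)).hasDerivAt
    refine (h1.comp s (hexp x s)).congr_deriv ?_
    ring
  have hlip : ∀ x a s : ℝ, |ψ (Real.exp (-s / 4) * x) - ψ (Real.exp (-a / 4) * x)|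
      ≤ C / 4 * |s - a| := by
    intro x a s
    refine Convex.norm_image_sub_le_of_norm_hasDerivWithin_le (s := univ)
      (f := fun s => ψ (Real.exp (-s / 4) * x))
      (fun y _ => (hd ψ hψ1 x y).hasDerivWithinAt) (fun y _ => ?_) convex_univ trivial trivial
    rw [norm_mul]
    have : ‖Real.exp (-y / 4) * x * deriv ψ (Real.exp (-y / 4) * x)‖ ≤ C :=
      hC (Real.exp (-y / 4) * x)
    rw [norm_neg, Real.norm_of_nonneg (by norm_num : (0 : ℝ) ≤ 1 / 4)]
    linarith
  refine ⟨C / 16, fun a s x => ?_⟩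
  have h1 : ∀ y, HasDerivAt (fun s => φ (Real.exp (-s / 4) * x)
      + (s - a) / 4 * ψ (Real.exp (-a / 4) * x))
      (-(1 / 4) * (ψ (Real.exp (-y / 4) * x) - ψ (Real.exp (-a / 4) * x))) y := by
    intro y
    have h2 := (((hasDerivAt_id y).sub_const a).div_const 4).mul_const (ψ (Real.exp (-a / 4) * x))
    refine ((hd φ (hφ.of_le (by norm_num)) x y).add h2).congr_deriv ?_
    simp only [hψ]; ring
  have h2 := Convex.norm_image_sub_le_of_norm_hasDerivWithin_le (s := uIcc a s) (x := a) (y := s)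
      (C := C / 16 * |s - a|) (fun y _ => (h1 y).hasDerivWithinAt) (fun y hy => by
        rw [norm_mul]
        have h3 := hlip x a y
        have h4 : |y - a| ≤ |s - a| := abs_sub_left_of_mem_uIcc hy
        have h5 : C / 4 * |y - a| ≤ C / 4 * |s - a| := by gcongr
        norm_num
        linarith) (convex_uIcc a s) left_mem_uIcc right_mem_uIcc
  simp only [Real.norm_eq_abs, sub_self, zero_div, zero_mul, add_zero] at h2
  calc _ = _ := by congr 1; simp only [hψ]; ring
    _ ≤ _ := h2
    _ = _ := by ring

/-- Testing the equation against `φ (e^{-t/4} ·)` removes the drift term. -/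
lemma IsSolution.hasDerivWithinAt_dilation {g : ℝ → ℝ → ℝ} (hg : IsSolution g)
    (h0 : ∫ x, g 0 x = 1) {φ : ℝ → ℝ} (hφ : ContDiff ℝ 2 φ) (hc : HasCompactSupport φ)
    {t : ℝ} (ht : 0 ≤ t) :
    HasDerivWithinAt (fun s : ℝ => ∫ x : ℝ, φ (Real.exp (-s / 4) * x) * g s x)
      (gain (g t) (fun x => φ (Real.exp (-t / 4) * x))
        - ∫ x, φ (Real.exp (-t / 4) * x) * g t x) (Ici 0) t := by
  obtain ⟨C, hC⟩ := exists_dilation_taylor hφ hc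
  set a : ℝ := Real.exp (-t / 4) with ha
  have ha0 : a ≠ 0 := (Real.exp_pos _).ne'
  have hφ' : ContDiff ℝ 1 (deriv φ) := (contDiff_succ_iff_deriv.1 hφ).2.2
  set ψ : ℝ → ℝ := fun x => x * deriv φ x with hψ
  have hψ1 : ContDiff ℝ 1 ψ := contDiff_id.mul hφ'
  have hψc : HasCompactSupport ψ := hc.deriv.mul_left
  have hdil : ∀ f : ℝ → ℝ, ContDiff ℝ 1 f → HasCompactSupport f →
      IsTest (fun x => f (a * x)) := by
    intro f hf hfc
    exact isTest_of_hasCompactSupport (hf.comp (contDiff_const.mul contDiff_id))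
      (hfc.comp_homeomorph (Homeomorph.mulLeft₀ a ha0))
  have tφ := hdil φ (hφ.of_le (by norm_num)) hc
  have tψ := hdil ψ hψ1 hψc
  have dφ := hg.weak_gain h0 tφ ht
  have dψ := hg.weak_gain h0 tψ ht
  obtain ⟨Mφ, hMφ⟩ := tφ.2
  obtain ⟨Mψ, hMψ⟩ := tψ.2
  have hrem : HasDerivWithinAt (fun s => ∫ x, (φ (Real.exp (-s / 4) * x) - φ (a * x)
      + (s - t) / 4 * ψ (a * x)) * g s x) 0 (Ici 0) t := by
    refine HasFDerivWithinAt.hasDerivWithinAt (f' := 0)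
      (Asymptotics.IsBigO.hasFDerivWithinAt (n := 2) ?_ ht (by norm_num))
    refine Asymptotics.IsBigO.of_bound C ?_
    filter_upwards [self_mem_nhdsWithin] with s hs
    have := abs_integral_mul_le (hC t s) (hg.integrable hs)
    rw [hg.integral_abs h0 hs, mul_one] at this
    simpa using this
  have hlin := ((((hasDerivWithinAt_id t (Ici 0)).sub_const t).div_const 4)).mul dψ
  have hsum := (hrem.add dφ).sub hlin
  have hEuler : ∫ x, x * deriv (fun x => φ (a * x)) x * g t x = ∫ x, ψ (a * x) * g t x := by
    congr 1 with x
    rw [deriv_comp_mul_left, smul_eq_mul]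
    simp only [hψ]
    ring
  refine (hsum.congr_of_mem (fun s hs => ?_) ht).congr_deriv ?_
  · simp only [Pi.add_apply, Pi.sub_apply, Pi.mul_apply, id]
    have hi := hg.integrable hs
    obtain ⟨Mφ', hMφ'⟩ := hc.exists_bound_of_continuous hφ.continuous
    have i1 := integrable_mul_of_bounded (φ := fun x => φ (Real.exp (-s / 4) * x))
      (by have := hφ.continuous; fun_prop) (fun x => hMφ' _) hi
    have i2 := integrable_mul_of_bounded tφ.1.continuous (fun x => (hMφ x).1) hi
    have i3 := integrable_mul_of_bounded tψ.1.continuous (fun x => (hMψ x).1) hi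
    have h4 : (fun x => (φ (Real.exp (-s / 4) * x) - φ (a * x)
      + (s - t) / 4 * ψ (a * x)) * g s x) = fun x => φ (Real.exp (-s / 4) * x) * g s x
        - φ (a * x) * g s x + (s - t) / 4 * (ψ (a * x) * g s x) := by ext x; ring
    have i12 : Integrable (fun x => φ (Real.exp (-s / 4) * x) * g s x - φ (a * x) * g s x) :=
      i1.sub i2
    rw [h4, integral_add i12 (i3.const_mul _), integral_sub i1 i2, integral_const_mul]
    ring
  · rw [hEuler]
    simp only [id]
    ring

/-! ### The equation on the Fourier side -/

/-- Mild form of the equation against a compactly supported test function. -/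
lemma IsSolution.mild_of_hasCompactSupport {g : ℝ → ℝ → ℝ} (hg : IsSolution g)
    (h0 : ∫ x, g 0 x = 1) {φ : ℝ → ℝ} (hφ : ContDiff ℝ 2 φ) (hc : HasCompactSupport φ)
    {t : ℝ} (ht : 0 ≤ t) :
    AEStronglyMeasurable (fun s => gain (g s) (fun x => φ (Real.exp (-s / 4) * x)))
      (volume.restrict (Ioc 0 t)) ∧
    Real.exp t * ∫ x, φ (Real.exp (-t / 4) * x) * g t x = (∫ x, φ x * g 0 x)
      + ∫ s in (0 : ℝ)..t, Real.exp s * gain (g s) (fun x => φ (Real.exp (-s / 4) * x)) := by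
  set A : ℝ → ℝ := fun s => ∫ x : ℝ, φ (Real.exp (-s / 4) * x) * g s x with hA
  set Q : ℝ → ℝ := fun s => gain (g s) (fun x => φ (Real.exp (-s / 4) * x)) with hQ
  have hd : ∀ s, 0 ≤ s → HasDerivWithinAt (fun s => Real.exp s * A s) (Real.exp s * Q s)
      (Ici 0) s := by
    intro s hs
    refine ((Real.hasDerivAt_exp s).hasDerivWithinAt.mul
      (hg.hasDerivWithinAt_dilation h0 hφ hc hs)).congr_deriv ?_
    ring
  obtain ⟨M, hM⟩ := hc.exists_bound_of_continuous hφ.continuous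
  have hQM : ∀ s, 0 ≤ s → |Q s| ≤ M := by
    intro s hs
    refine (abs_gain_le (M := M) (fun x => hM _) (hg.integrable hs)).trans_eq ?_
    rw [hg.integral_abs h0 hs]; ring
  have hmeas : AEStronglyMeasurable (fun s => Real.exp s * Q s) (volume.restrict (Ioc 0 t)) := by
    refine (stronglyMeasurable_deriv (fun s => Real.exp s * A s)).aestronglyMeasurable.congr ?_
    filter_upwards [ae_restrict_mem measurableSet_Ioc] with s hs
    exact ((hd s hs.1.le).hasDerivAt (Ici_mem_nhds hs.1)).deriv
  refine ⟨?_, ?_⟩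
  · have h1 : AEStronglyMeasurable (fun s : ℝ => Real.exp (-s)) (volume.restrict (Ioc 0 t)) :=
      Continuous.aestronglyMeasurable (by fun_prop)
    refine (h1.mul hmeas).congr (ae_of_all _ fun s => ?_)
    simp only [Pi.mul_apply]
    rw [← mul_assoc, ← Real.exp_add]; simp
  · have hint : IntervalIntegrable (fun s => Real.exp s * Q s) volume 0 t := by
      rw [intervalIntegrable_iff_integrableOn_Ioc_of_le ht]
      refine Integrable.mono' (integrable_const (Real.exp t * M)) hmeas ?_
      filter_upwards [ae_restrict_mem measurableSet_Ioc] with s hs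
      rw [norm_mul, Real.norm_of_nonneg (Real.exp_pos _).le]
      exact mul_le_mul (Real.exp_le_exp.2 hs.2) (hQM s hs.1.le) (norm_nonneg _) (Real.exp_pos _).le
    have := intervalIntegral.integral_eq_sub_of_hasDeriv_right (a := 0) (b := t)
      (f := fun s => Real.exp s * A s) (f' := fun s => Real.exp s * Q s)
      (by
        rw [uIcc_of_le ht]
        exact fun s hs => (hd s hs.1).continuousWithinAt.mono Icc_subset_Ici_self)
      (by
        rw [min_eq_left ht]
        exact fun s hs => (hd s hs.1.le).mono (fun y hy => hs.1.le.trans (le_of_lt hy))) hint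
    rw [this]
    simp [hA]

/-- The mild form against bounded smooth test functions, by truncation. -/
lemma IsSolution.mild_of_bounded {g : ℝ → ℝ → ℝ} (hg : IsSolution g)
    (h0 : ∫ x, g 0 x = 1) {φ : ℝ → ℝ} (hφ : ContDiff ℝ 2 φ) (hb : ∀ x, |φ x| ≤ 1)
    {t : ℝ} (ht : 0 ≤ t) :
    AEStronglyMeasurable (fun s => gain (g s) (fun x => φ (Real.exp (-s / 4) * x)))
      (volume.restrict (Ioc 0 t)) ∧
    Real.exp t * ∫ x, φ (Real.exp (-t / 4) * x) * g t x = (∫ x, φ x * g 0 x)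
      + ∫ s in (0 : ℝ)..t, Real.exp s * gain (g s) (fun x => φ (Real.exp (-s / 4) * x)) := by
  let χ : ContDiffBump (0 : ℝ) := ⟨1, 2, one_pos, one_lt_two⟩
  set φn : ℕ → ℝ → ℝ := fun n x => χ (((n : ℝ) + 1)⁻¹ * x) * φ x with hφn
  have hpos : ∀ n : ℕ, (0 : ℝ) < ((n : ℝ) + 1)⁻¹ := fun n => by positivity
  have hsm : ∀ n, ContDiff ℝ 2 (φn n) := fun n =>
    (χ.contDiff.comp (contDiff_const.mul contDiff_id)).mul hφ
  have hcs : ∀ n, HasCompactSupport (φn n) := fun n =>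
    (χ.hasCompactSupport.comp_homeomorph (Homeomorph.mulLeft₀ _ (hpos n).ne')).mul_right
  have hbd : ∀ n x, |φn n x| ≤ 1 := by
    intro n x
    rw [hφn, abs_mul, abs_of_nonneg χ.nonneg]
    exact mul_le_one₀ χ.le_one (abs_nonneg _) (hb x)
  have hlim : ∀ x, Tendsto (fun n => φn n x) atTop (𝓝 (φ x)) := by
    intro x
    refine tendsto_const_nhds.congr' ?_
    filter_upwards [eventually_ge_atTop ⌈|x|⌉₊] with n hn
    have hx : |x| ≤ n := (Nat.le_ceil _).trans (by exact_mod_cast hn)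
    have : ((n : ℝ) + 1)⁻¹ * x ∈ Metric.closedBall (0 : ℝ) 1 := by
      rw [mem_closedBall_zero_iff, norm_mul, Real.norm_of_nonneg (hpos n).le, Real.norm_eq_abs,
        inv_mul_le_iff₀ (by linarith [abs_nonneg x])]
      linarith
    simp only [hφn]
    rw [χ.one_of_mem_closedBall this, one_mul]
  have hlin : ∀ s a, 0 ≤ s → Tendsto (fun n => ∫ x, φn n (a * x) * g s x) atTop
      (𝓝 (∫ x, φ (a * x) * g s x)) := by
    intro s a hs
    refine tendsto_integral_of_dominated_convergence (fun x => |g s x|) (fun n => ?_)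
      (hg.integrable hs).abs (fun n => ae_of_all _ fun x => ?_) (ae_of_all _ fun x => ?_)
    · have := (hsm n).continuous
      exact (Continuous.aestronglyMeasurable (by fun_prop)).mul (hg.integrable hs).1
    · rw [norm_mul]
      exact mul_le_of_le_one_left (norm_nonneg _) (hbd n _)
    · exact (hlim _).mul_const _
  have hquad : ∀ s a, 0 ≤ s → Tendsto (fun n => gain (g s) (fun x => φn n (a * x))) atTop
      (𝓝 (gain (g s) (fun x => φ (a * x)))) := by
    intro s a hs
    have hi := hg.integrable hs
    refine tendsto_integral_of_dominated_convergence (fun p : ℝ × ℝ => |g s p.1| * |g s p.2|)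
      (fun n => ?_) (hi.abs.mul_prod hi.abs) (fun n => ae_of_all _ fun p => ?_)
      (ae_of_all _ fun x => ?_)
    · have := (hsm n).continuous
      exact (Continuous.aestronglyMeasurable (by fun_prop)).mul (hi.mul_prod hi).1
    · rw [← abs_mul, norm_mul]
      exact mul_le_of_le_one_left (norm_nonneg _) (hbd n _)
    · exact (hlim _).mul_const _
  have hmild := fun n => hg.mild_of_hasCompactSupport h0 (hsm n) (hcs n) ht
  have hlimQ : ∀ᵐ s ∂(volume.restrict (Ioc 0 t)), Tendsto
      (fun n => gain (g s) (fun x => φn n (Real.exp (-s / 4) * x))) atTop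
      (𝓝 (gain (g s) (fun x => φ (Real.exp (-s / 4) * x)))) := by
    filter_upwards [ae_restrict_mem measurableSet_Ioc] with s hs using hquad s _ hs.1.le
  refine ⟨aestronglyMeasurable_of_tendsto_ae atTop (fun n => (hmild n).1) hlimQ, ?_⟩
  have hR : Tendsto (fun n => ∫ s in (0 : ℝ)..t,
      Real.exp s * gain (g s) (fun x => φn n (Real.exp (-s / 4) * x))) atTop
      (𝓝 (∫ s in (0 : ℝ)..t, Real.exp s * gain (g s) (fun x => φ (Real.exp (-s / 4) * x)))) := by
    refine intervalIntegral.tendsto_integral_filter_of_dominated_convergence (fun s => Real.exp s)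
      (Eventually.of_forall fun n => ?_) (Eventually.of_forall fun n => ae_of_all _ fun s hs => ?_)
      (Continuous.intervalIntegrable (by fun_prop) _ _) ?_
    · rw [uIoc_of_le ht]
      exact (Continuous.aestronglyMeasurable (by fun_prop)).mul (hmild n).1
    · rw [uIoc_of_le ht] at hs
      rw [norm_mul, Real.norm_of_nonneg (Real.exp_pos _).le]
      refine mul_le_of_le_one_right (Real.exp_pos _).le ?_
      refine (abs_gain_le (M := 1) (fun x => hbd n _) (hg.integrable hs.1.le)).trans_eq ?_
      rw [hg.integral_abs h0 hs.1.le]; ring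
    · refine ae_of_all _ fun s hs => ?_
      rw [uIoc_of_le ht] at hs
      exact (hquad s _ hs.1.le).const_mul _
  have hL := (hlin t (Real.exp (-t / 4)) ht).const_mul (Real.exp t)
  have hI := hlin 0 1 le_rfl
  simp only [one_mul] at hI
  refine tendsto_nhds_unique hL ((hI.add hR).congr fun n => ?_)
  exact (hmild n).2.symm

lemma fourier_eq_cos_sin {f : ℝ → ℝ} (hf : Integrable f) (ξ : ℝ) :
    fourier f ξ = ((∫ x, Real.cos (ξ * x) * f x : ℝ) : ℂ)
      + ((∫ x, -Real.sin (ξ * x) * f x : ℝ) : ℂ) * Complex.I := by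
  have h1 := integrable_mul_of_bounded (φ := fun x => Real.cos (ξ * x)) (M := 1) (by fun_prop)
    (fun x => Real.abs_cos_le_one _) hf
  have h2 := integrable_mul_of_bounded (φ := fun x => -Real.sin (ξ * x)) (M := 1) (by fun_prop)
    (fun x => by rw [abs_neg]; exact Real.abs_sin_le_one _) hf
  unfold fourier
  rw [← integral_complex_ofReal, ← integral_complex_ofReal, ← integral_mul_const,
    ← integral_add h1.ofReal (h2.ofReal.mul_const _)]
  congr 1 with x
  have : -(Complex.I * x * ξ) = ((-(ξ * x) : ℝ) : ℂ) * Complex.I := by push_cast; ring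
  rw [this, Complex.exp_mul_I, ← Complex.ofReal_cos, ← Complex.ofReal_sin, Real.cos_neg,
    Real.sin_neg]
  push_cast
  ring

/-- The gain term is quadratic in the Fourier transform. -/
lemma fourier_sq_eq_gain {f : ℝ → ℝ} (hf : Integrable f) (η : ℝ) :
    fourier f (η / 2) ^ 2 = (gain f (fun x => Real.cos (η * x)) : ℂ)
      + (gain f (fun x => -Real.sin (η * x)) : ℂ) * Complex.I := by
  have h1 := integrable_prod_of_bounded (φ := fun p => Real.cos (η * ((p.1 + p.2) / 2))) (M := 1)
    (by fun_prop) (fun x => Real.abs_cos_le_one _) hf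
  have h2 := integrable_prod_of_bounded (φ := fun p => -Real.sin (η * ((p.1 + p.2) / 2))) (M := 1)
    (by fun_prop) (fun x => by rw [abs_neg]; exact Real.abs_sin_le_one _) hf
  unfold fourier gain
  simp only
  have e := integral_add (μ := volume) (h1.ofReal (𝕜 := ℂ))
    ((h2.ofReal (𝕜 := ℂ)).mul_const Complex.I)
  rw [integral_mul_const] at e
  rw [sq, ← integral_complex_ofReal, ← integral_complex_ofReal]
  refine Eq.trans ?_ e
  rw [← integral_prod_mul]
  congr 1 with p
  have : Complex.exp (-(Complex.I * p.1 * (η / 2 : ℝ))) * Complex.exp (-(Complex.I * p.2 * (η / 2 : ℝ)))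
      = Complex.exp (((-(η * ((p.1 + p.2) / 2)) : ℝ) : ℂ) * Complex.I) := by
    rw [← Complex.exp_add]; congr 1; push_cast; ring
  calc _ = (f p.1 : ℂ) * f p.2 * (Complex.exp (-(Complex.I * p.1 * (η / 2 : ℝ)))
        * Complex.exp (-(Complex.I * p.2 * (η / 2 : ℝ)))) := by ring
    _ = _ := by
      rw [this, Complex.exp_mul_I, ← Complex.ofReal_cos, ← Complex.ofReal_sin, Real.cos_neg,
        Real.sin_neg]
      simp only [Complex.coe_algebraMap, Complex.ofReal_mul, Complex.ofReal_neg]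
      ring

/-- The mild form of the equation on the Fourier side, along the characteristics
`t ↦ ξ e^{-t/4}`. -/
lemma IsSolution.fourier_mild {g : ℝ → ℝ → ℝ} (hg : IsSolution g) (h0 : ∫ x, g 0 x = 1) (ξ : ℝ)
    {t : ℝ} (ht : 0 ≤ t) :
    IntervalIntegrable (fun s => (Real.exp s : ℂ) * fourier (g s) (ξ * Real.exp (-s / 4) / 2) ^ 2)
      volume 0 t ∧
    (Real.exp t : ℂ) * fourier (g t) (ξ * Real.exp (-t / 4)) = fourier (g 0) ξ
      + ∫ s in (0 : ℝ)..t, (Real.exp s : ℂ) * fourier (g s) (ξ * Real.exp (-s / 4) / 2) ^ 2 := by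
  obtain ⟨mc, ec⟩ := hg.mild_of_bounded h0 (φ := fun x => Real.cos (ξ * x))
    (Real.contDiff_cos.comp (contDiff_const.mul contDiff_id)) (fun x => Real.abs_cos_le_one _) ht
  obtain ⟨ms, es⟩ := hg.mild_of_bounded h0 (φ := fun x => -Real.sin (ξ * x))
    (Real.contDiff_sin.comp (contDiff_const.mul contDiff_id)).neg
    (fun x => by rw [abs_neg]; exact Real.abs_sin_le_one _) ht
  simp only [← mul_assoc] at mc ec ms es
  have hint : ∀ φ : ℝ → ℝ → ℝ, (∀ s x, |φ s x| ≤ 1) →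
      AEStronglyMeasurable (fun s => gain (g s) (φ s)) (volume.restrict (Ioc 0 t)) →
      IntervalIntegrable (fun s => Real.exp s * gain (g s) (φ s)) volume 0 t := by
    intro φ hφ hm
    rw [intervalIntegrable_iff_integrableOn_Ioc_of_le ht]
    refine Integrable.mono' (integrable_const (Real.exp t))
      ((Continuous.aestronglyMeasurable (by fun_prop)).mul hm) ?_
    filter_upwards [ae_restrict_mem measurableSet_Ioc] with s hs
    rw [norm_mul, Real.norm_of_nonneg (Real.exp_pos _).le]
    have h1 : |gain (g s) (φ s)| ≤ 1 := by
      refine (abs_gain_le (M := 1) (hφ s) (hg.integrable hs.1.le)).trans_eq ?_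
      rw [hg.integral_abs h0 hs.1.le]; ring
    exact (mul_le_of_le_one_right (Real.exp_pos _).le h1).trans (Real.exp_le_exp.2 hs.2)
  have ic := hint (fun s x => Real.cos (ξ * Real.exp (-s / 4) * x))
    (fun s x => Real.abs_cos_le_one _) mc
  have is := hint (fun s x => -Real.sin (ξ * Real.exp (-s / 4) * x))
    (fun s x => by rw [abs_neg]; exact Real.abs_sin_le_one _) ms
  have heq : ∀ s, 0 ≤ s → (Real.exp s : ℂ) * fourier (g s) (ξ * Real.exp (-s / 4) / 2) ^ 2
      = ((Real.exp s * gain (g s) (fun x => Real.cos (ξ * Real.exp (-s / 4) * x)) : ℝ) : ℂ)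
        + ((Real.exp s * gain (g s) (fun x => -Real.sin (ξ * Real.exp (-s / 4) * x)) : ℝ) : ℂ)
          * Complex.I := by
    intro s hs
    rw [fourier_sq_eq_gain (hg.integrable hs)]
    push_cast; ring
  have ic' : IntervalIntegrable (fun s =>
    ((Real.exp s * gain (g s) (fun x => Real.cos (ξ * Real.exp (-s / 4) * x)) : ℝ) : ℂ))
      volume 0 t := ⟨ic.1.ofReal, ic.2.ofReal⟩
  have is' : IntervalIntegrable (fun s =>
    ((Real.exp s * gain (g s) (fun x => -Real.sin (ξ * Real.exp (-s / 4) * x)) : ℝ) : ℂ)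
      * Complex.I) volume 0 t :=
    IntervalIntegrable.mul_const ⟨is.1.ofReal, is.2.ofReal⟩ _
  refine ⟨(ic'.add is').congr fun s hs => ?_, ?_⟩
  · rw [uIoc_of_le ht] at hs
    exact (heq s hs.1.le).symm
  · have : ∫ s in (0 : ℝ)..t, (Real.exp s : ℂ) * fourier (g s) (ξ * Real.exp (-s / 4) / 2) ^ 2
        = ∫ s in (0 : ℝ)..t,
        (((Real.exp s * gain (g s) (fun x => Real.cos (ξ * Real.exp (-s / 4) * x)) : ℝ) : ℂ)
        + ((Real.exp s * gain (g s) (fun x => -Real.sin (ξ * Real.exp (-s / 4) * x)) : ℝ) : ℂ)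
          * Complex.I) := by
      refine intervalIntegral.integral_congr fun s hs => ?_
      rw [uIcc_of_le ht] at hs
      exact heq s hs.1
    rw [this, intervalIntegral.integral_add ic' is', intervalIntegral.integral_mul_const,
      intervalIntegral.integral_ofReal, intervalIntegral.integral_ofReal,
      fourier_eq_cos_sin (hg.integrable ht), fourier_eq_cos_sin (hg.integrable le_rfl)]
    have ec' := congrArg (fun r : ℝ => (r : ℂ)) ec
    have es' := congrArg (fun r : ℝ => (r : ℂ)) es
    push_cast at ec' es' ⊢
    linear_combination ec' + Complex.I * es'

lemma IsSolution.continuousOn_fourier {g : ℝ → ℝ → ℝ} (hg : IsSolution g) (h0 : ∫ x, g 0 x = 1)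
    (ξ : ℝ) : ContinuousOn (fun t => fourier (g t) (ξ * Real.exp (-t / 4))) (Ici 0) := by
  suffices h : ∀ T, 0 < T → ContinuousOn
      (fun t => (Real.exp t : ℂ) * fourier (g t) (ξ * Real.exp (-t / 4))) (Icc 0 T) by
    intro t ht
    have h1 := (h (t + 1) (by have : 0 ≤ t := ht; linarith)) t ⟨ht, by linarith⟩
    have h2 : ContinuousWithinAt
        (fun t => (Real.exp t : ℂ) * fourier (g t) (ξ * Real.exp (-t / 4))) (Ici 0) t := by
      refine h1.mono_of_mem_nhdsWithin ?_
      rw [← Ici_inter_Iic]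
      exact inter_mem self_mem_nhdsWithin (mem_nhdsWithin_of_mem_nhds (Iic_mem_nhds (by linarith)))
    have h3 : ContinuousWithinAt (fun t : ℝ => (Real.exp (-t) : ℂ)) (Ici 0) t := by fun_prop
    refine (h3.mul h2).congr (fun s _ => ?_) ?_ <;>
    · simp only [Pi.mul_apply]
      rw [← mul_assoc, ← Complex.ofReal_mul, ← Real.exp_add]; simp
  intro T hT
  have h1 := (hg.fourier_mild h0 ξ hT.le).1
  have h2 := intervalIntegral.continuousOn_primitive_interval'
    (f := fun s => (Real.exp s : ℂ) * fourier (g s) (ξ * Real.exp (-s / 4) / 2) ^ 2)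
    h1 (left_mem_uIcc)
  rw [uIcc_of_le hT.le] at h2
  refine ((continuousOn_const (c := fourier (g 0) ξ)).add h2).congr fun t ht => ?_
  exact (hg.fourier_mild h0 ξ ht.1).2

/-- The equation along characteristics: `∂ₜ [eᵗ ĝ(t, ξ e^{-t/4})] = eᵗ ĝ(t, ξ e^{-t/4} / 2)²`. -/
lemma IsSolution.hasDerivWithinAt_fourier {g : ℝ → ℝ → ℝ} (hg : IsSolution g)
    (h0 : ∫ x, g 0 x = 1) (ξ : ℝ) {t : ℝ} (ht : 0 ≤ t) :
    HasDerivWithinAt (fun t => (Real.exp t : ℂ) * fourier (g t) (ξ * Real.exp (-t / 4)))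
      ((Real.exp t : ℂ) * fourier (g t) (ξ * Real.exp (-t / 4) / 2) ^ 2) (Ici t) t := by
  have hc : ContinuousOn (fun s => (Real.exp s : ℂ) *
      fourier (g s) (ξ * Real.exp (-s / 4) / 2) ^ 2) (Ici 0) := by
    have := hg.continuousOn_fourier h0 (ξ / 2)
    refine ContinuousOn.mul (by fun_prop) (ContinuousOn.pow (this.congr fun s _ => ?_) 2)
    simp only
    congr 1; ring
  set h : ℝ → ℂ := fun s => (Real.exp (max s 0) : ℂ) *
      fourier (g (max s 0)) (ξ * Real.exp (-(max s 0) / 4) / 2) ^ 2 with hh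
  have hcont : Continuous h := by
    rw [← continuousOn_univ]
    exact hc.comp (f := fun s : ℝ => max s 0) (by fun_prop)
      (fun s _ => mem_Ici.2 (le_max_right s 0))
  have hder := (intervalIntegral.integral_hasDerivAt_right (hcont.intervalIntegrable 0 t)
    (hcont.stronglyMeasurableAtFilter _ _) hcont.continuousAt).hasDerivWithinAt (s := Ici t)
  have hd2 := hder.const_add (fourier (g 0) ξ)
  have hmax : max t 0 = t := max_eq_left ht
  refine (hd2.congr_of_mem (fun s hs => ?_) (self_mem_Ici)).congr_deriv ?_
  · have hs0 : 0 ≤ s := ht.trans hs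
    rw [(hg.fourier_mild h0 ξ hs0).2]
    congr 1
    refine intervalIntegral.integral_congr fun r hr => ?_
    rw [uIcc_of_le hs0] at hr
    simp only [hh, max_eq_left hr.1]
  · simp only [hh, hmax]

/-! ### Pointwise comparison along characteristics -/

/-- `W` solves `∂ₜ W = (1/4) ξ ∂_ξ W - W + N(t, ξ / 2)` in the sense of characteristics:
`eᵗ W(t, ξ e^{-t/4})` is continuous with right derivative `eᵗ N(t, ξ e^{-t/4} / 2)`. -/
structure IsTransported (W N : ℝ → ℝ → ℂ) : Prop where
  continuousOn : ∀ ξ, ContinuousOn (fun t => (Real.exp t : ℂ) * W t (ξ * Real.exp (-t / 4))) (Ici 0)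
  hasDeriv : ∀ ξ t, 0 ≤ t → HasDerivWithinAt
    (fun t => (Real.exp t : ℂ) * W t (ξ * Real.exp (-t / 4)))
    ((Real.exp t : ℂ) * N t (ξ * Real.exp (-t / 4) / 2)) (Ici t) t

lemma IsSolution.isTransported {g : ℝ → ℝ → ℝ} (hg : IsSolution g) (h0 : ∫ x, g 0 x = 1) :
    IsTransported (fun t => fourier (g t)) (fun t ξ => fourier (g t) ξ ^ 2) where
  continuousOn ξ := ContinuousOn.mul (by fun_prop) (hg.continuousOn_fourier h0 ξ)
  hasDeriv ξ _ ht := hg.hasDerivWithinAt_fourier h0 ξ ht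

/-- `steady` is a stationary solution, written along characteristics. -/
lemma hasDerivAt_exp_mul_steady (ξ t : ℝ) :
    HasDerivAt (fun t => Real.exp t * steady (ξ * Real.exp (-t / 4)))
      (Real.exp t * steady (ξ * Real.exp (-t / 4) / 2) ^ 2) t := by
  have hr : HasDerivAt (fun t => |ξ| * Real.exp (-t / 4))
      (-(1 / 4) * (|ξ| * Real.exp (-t / 4))) t := by
    refine (((hasDerivAt_id t).neg.div_const 4).exp.const_mul |ξ|).congr_deriv ?_
    simp only [Pi.neg_apply, id]; ring
  have h := (Real.hasDerivAt_exp t).mul ((hr.const_add 1).mul hr.neg.exp)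
  have habs : ∀ s : ℝ, |ξ * Real.exp (-s / 4)| = |ξ| * Real.exp (-s / 4) := fun s => by
    rw [abs_mul, abs_of_pos (Real.exp_pos _)]
  have hfun : (fun t => Real.exp t * steady (ξ * Real.exp (-t / 4))) =
      Real.exp * ((fun t => 1 + |ξ| * Real.exp (-t / 4)) *
        fun t => Real.exp ((-fun t => |ξ| * Real.exp (-t / 4)) t)) := by
    ext s
    simp [steady, abs_mul]
  rw [hfun]
  refine h.congr_deriv ?_
  simp only [steady, abs_div, habs, Pi.neg_apply, abs_two]
  set r := |ξ| * Real.exp (-t / 4)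
  have he : Real.exp (-r) = Real.exp (-(r / 2)) ^ 2 := by
    rw [← Real.exp_nat_mul]; congr 1; push_cast; ring
  simp only [Pi.mul_apply]
  rw [he]
  ring

lemma isTransported_steady :
    IsTransported (fun _ ξ => (steady ξ : ℂ)) (fun _ ξ => (steady ξ : ℂ) ^ 2) where
  continuousOn ξ := by
    have := continuous_steady
    fun_prop
  hasDeriv ξ t _ := by
    have := (hasDerivAt_exp_mul_steady ξ t).ofReal_comp.hasDerivWithinAt (s := Ici t)
    push_cast at this ⊢
    exact this

lemma IsTransported.sub {W N W' N' : ℝ → ℝ → ℂ} (h : IsTransported W N)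
    (h' : IsTransported W' N') :
    IsTransported (fun t ξ => W t ξ - W' t ξ) (fun t ξ => N t ξ - N' t ξ) where
  continuousOn ξ := ((h.continuousOn ξ).sub (h'.continuousOn ξ)).congr fun t _ => by
    simp only [Pi.sub_apply]; ring
  hasDeriv ξ t ht := by
    refine (((h.hasDeriv ξ t ht).sub (h'.hasDeriv ξ t ht)).congr_of_mem (fun s _ => ?_)
      self_mem_Ici).congr_deriv ?_
    · simp only [Pi.sub_apply]; ring
    · ring

/-- Comparison along one characteristic. -/
lemma IsTransported.norm_le {W N : ℝ → ℝ → ℂ} (h : IsTransported W N) {T : ℝ} (hT : 0 ≤ T) (ξ : ℝ)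
    {B B' : ℝ → ℝ} (h0 : ‖W 0 (ξ * Real.exp (T / 4))‖ ≤ B 0)
    (hB : ∀ s, HasDerivAt B (B' s) s)
    (hN : ∀ s, 0 ≤ s → s < T → Real.exp s * ‖N s (ξ * Real.exp ((T - s) / 4) / 2)‖ ≤ B' s) :
    ‖W T ξ‖ ≤ Real.exp (-T) * B T := by
  have hchar : ∀ s, ξ * Real.exp (T / 4) * Real.exp (-s / 4) = ξ * Real.exp ((T - s) / 4) := by
    intro s; rw [mul_assoc, ← Real.exp_add]; ring_nf
  have key := image_norm_le_of_norm_deriv_right_le_deriv_boundary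
    (f := fun t => (Real.exp t : ℂ) * W t (ξ * Real.exp (T / 4) * Real.exp (-t / 4)))
    (f' := fun t => (Real.exp t : ℂ) * N t (ξ * Real.exp (T / 4) * Real.exp (-t / 4) / 2))
    (a := 0) (b := T)
    ((h.continuousOn _).mono Icc_subset_Ici_self) (fun s hs => h.hasDeriv _ s hs.1)
    (by simpa using h0) hB (fun s hs => by
      rw [hchar, norm_mul, Complex.norm_real, Real.norm_of_nonneg (Real.exp_pos _).le]
      exact hN s hs.1 hs.2) ⟨hT, le_rfl⟩
  simp only [hchar, sub_self, zero_div, Real.exp_zero, mul_one, norm_mul, Complex.norm_real,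
    Real.norm_of_nonneg (Real.exp_pos _).le] at key
  rw [Real.exp_neg, inv_mul_eq_div, le_div_iff₀ (Real.exp_pos _)]
  linarith

lemma hasDerivAt_pow_div_factorial (L s : ℝ) (n : ℕ) :
    HasDerivAt (fun s => (L * s) ^ (n + 1) / (n + 1).factorial)
      (L * ((L * s) ^ n / n.factorial)) s := by
  have := ((((hasDerivAt_id s).const_mul L).pow (n + 1)).div_const ((n + 1).factorial : ℝ))
  refine this.congr_deriv ?_
  rw [Nat.factorial_succ]
  have : (n.factorial : ℝ) ≠ 0 := by exact_mod_cast Nat.factorial_ne_zero n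
  push_cast
  field_simp
  simp

/-- The remainder of an iterated comparison vanishes in the limit. -/
lemma le_of_le_add_pow_div_factorial {a b K L : ℝ}
    (h : ∀ n : ℕ, a ≤ b + K * (L ^ n / n.factorial)) : a ≤ b := by
  have h1 := ((FloorSemiring.tendsto_pow_div_factorial_atTop L).const_mul K).const_add b
  rw [mul_zero, add_zero] at h1
  exact ge_of_tendsto' h1 h

/-- Convex combinations of the steady states `1` and `steady (a ·)` are barriers, because the
gain term `ĝ(ξ/2)²` is convex in `ĝ`. -/
lemma IsTransported.norm_le_barrier {F : ℝ → ℝ → ℂ} (h : IsTransported F (fun t ξ => F t ξ ^ 2))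
    (h1 : ∀ t ξ, 0 ≤ t → ‖F t ξ‖ ≤ 1) {d a : ℝ} (hd : 0 ≤ d) (hd1 : d ≤ 1)
    (h0 : ∀ ξ, ‖F 0 ξ‖ ≤ d + (1 - d) * steady (a * ξ)) {t : ℝ} (ht : 0 ≤ t) (ξ : ℝ) :
    ‖F t ξ‖ ≤ d + (1 - d) * steady (a * ξ) := by
  suffices H : ∀ n : ℕ, ∀ t ξ, 0 ≤ t →
      ‖F t ξ‖ ≤ d + (1 - d) * steady (a * ξ) + 1 * ((2 * t) ^ n / n.factorial) from
    le_of_le_add_pow_div_factorial fun n => H n t ξ ht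
  have hb0 : ∀ ξ, 0 ≤ d + (1 - d) * steady (a * ξ) := fun ξ =>
    add_nonneg hd (mul_nonneg (by linarith) (steady_pos _).le)
  have hb1 : ∀ ξ, d + (1 - d) * steady (a * ξ) ≤ 1 := fun ξ => by
    nlinarith [steady_le_one (a * ξ)]
  intro n
  induction n with
  | zero =>
    intro t ξ ht
    simp only [pow_zero, Nat.factorial_zero, Nat.cast_one, div_one, mul_one]
    linarith [h1 t ξ ht, hb0 ξ]
  | succ n ih =>
    intro T ξ hT
    have hB : ∀ s, HasDerivAt (fun s => Real.exp s * d
        + (1 - d) * (Real.exp s * steady (a * ξ * Real.exp (T / 4) * Real.exp (-s / 4)))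
        + Real.exp s * ((2 * s) ^ (n + 1) / (n + 1).factorial)) _ s := fun s =>
      (((Real.hasDerivAt_exp s).mul_const d).add
        ((hasDerivAt_exp_mul_steady (a * ξ * Real.exp (T / 4)) s).const_mul (1 - d))).add
        ((Real.hasDerivAt_exp s).mul (hasDerivAt_pow_div_factorial 2 s n))
    have key := h.norm_le hT ξ (B := fun s => Real.exp s * d
        + (1 - d) * (Real.exp s * steady (a * ξ * Real.exp (T / 4) * Real.exp (-s / 4)))
        + Real.exp s * ((2 * s) ^ (n + 1) / (n + 1).factorial)) ?_ hB ?_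
    · refine key.trans_eq ?_
      have e1 : a * ξ * Real.exp (T / 4) * Real.exp (-T / 4) = a * ξ := by
        rw [mul_assoc, ← Real.exp_add]; ring_nf; simp
      have e2 : Real.exp (-T) * Real.exp T = 1 := by rw [← Real.exp_add]; simp
      simp only [e1]
      linear_combination (d + (1 - d) * steady (a * ξ)
        + (2 * T) ^ (n + 1) / (n + 1).factorial) * e2
    · have := h0 (ξ * Real.exp (T / 4))
      simpa [mul_assoc] using this
    · intro s hs _
      set ζ := ξ * Real.exp ((T - s) / 4) / 2 with hζ
      have e1 : a * ξ * Real.exp (T / 4) * Real.exp (-s / 4) / 2 = a * ζ := by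
        rw [mul_assoc (a * ξ), ← Real.exp_add, hζ]; ring_nf
      rw [e1, norm_pow, ← mul_assoc, ← mul_add]
      set r := (2 * s) ^ n / (n.factorial : ℝ)
      have hr' : 0 ≤ (2 * s) ^ (n + 1) / ((n + 1).factorial : ℝ) := by positivity
      have hconv : (d + (1 - d) * steady (a * ζ)) ^ 2 ≤ d + (1 - d) * steady (a * ζ) ^ 2 := by
        nlinarith [mul_nonneg (mul_nonneg hd (sub_nonneg.2 hd1)) (sq_nonneg (1 - steady (a * ζ)))]
      -- above the barrier, `x² - y² = (x - y)(x + y) ≤ 2 (x - y)` for `x, y ≤ 1`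
      have hF : ‖F s ζ‖ ^ 2 ≤ (d + (1 - d) * steady (a * ζ)) ^ 2 + 2 * r := by
        have i1 := ih s ζ hs
        have i2 := h1 s ζ hs
        have i3 := hb0 ζ
        have i4 := hb1 ζ
        have i5 : 0 ≤ r := by positivity
        have i6 := norm_nonneg (F s ζ)
        rcases le_total ‖F s ζ‖ (d + (1 - d) * steady (a * ζ)) with hle | hle
        · have := pow_le_pow_left₀ i6 hle 2
          linarith
        · nlinarith
      have hexp := Real.exp_pos s
      have : Real.exp s * ‖F s ζ‖ ^ 2 ≤ Real.exp s * (d + (1 - d) * steady (a * ζ) ^ 2 + 2 * r) :=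
        mul_le_mul_of_nonneg_left (hF.trans (by linarith)) hexp.le
      have h3 : 0 ≤ Real.exp s * ((2 * s) ^ (n + 1) / ((n + 1).factorial : ℝ)) := by positivity
      linarith

/-- Exponential decay of the Fourier distance of order `κ`. -/
lemma IsTransported.norm_le_rpow {W N : ℝ → ℝ → ℂ} (h : IsTransported W N) {K : ℝ}
    (hK : ∀ t ξ, 0 ≤ t → ‖W t ξ‖ ≤ K) (hN : ∀ t ξ, 0 ≤ t → ‖N t ξ‖ ≤ 2 * ‖W t ξ‖)
    {M κ : ℝ} (hM : 0 ≤ M) (h0 : ∀ ξ, ‖W 0 ξ‖ ≤ M * |ξ| ^ κ) {t : ℝ} (ht : 0 ≤ t) (ξ : ℝ) :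
    ‖W t ξ‖ ≤ M * |ξ| ^ κ * Real.exp (-(1 - κ / 4 - 2 ^ (1 - κ)) * t) := by
  set lam := 1 - κ / 4 - (2 : ℝ) ^ (1 - κ) with hlam
  have hK0 : 0 ≤ K := (norm_nonneg _).trans (hK 0 0 le_rfl)
  suffices H : ∀ n : ℕ, ∀ t ξ, 0 ≤ t → ‖W t ξ‖ ≤ M * |ξ| ^ κ * Real.exp (-lam * t)
      + K * ((2 * t) ^ n / n.factorial) from
    le_of_le_add_pow_div_factorial fun n => H n t ξ ht
  intro n
  induction n with
  | zero =>
    intro t ξ ht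
    simp only [pow_zero, Nat.factorial_zero, Nat.cast_one, div_one, mul_one]
    have : 0 ≤ M * |ξ| ^ κ * Real.exp (-lam * t) := by positivity
    linarith [hK t ξ ht]
  | succ n ih =>
    intro T ξ hT
    set m := M * (|ξ| * Real.exp (T / 4)) ^ κ with hm
    set μ := (2 : ℝ) ^ (1 - κ) with hμ
    have hB : ∀ s, HasDerivAt (fun s => m * Real.exp (μ * s)
        + K * (Real.exp s * ((2 * s) ^ (n + 1) / (n + 1).factorial))) _ s := fun s =>
      (((hasDerivAt_id s).const_mul μ).exp.const_mul m).add
        (((Real.hasDerivAt_exp s).mul (hasDerivAt_pow_div_factorial 2 s n)).const_mul K)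
    have hpow : ∀ s, (|ξ| * Real.exp (s / 4)) ^ κ = |ξ| ^ κ * Real.exp (κ / 4 * s) := by
      intro s
      rw [Real.mul_rpow (abs_nonneg _) (Real.exp_pos _).le, ← Real.exp_mul]
      ring_nf
    have key := h.norm_le hT ξ (B := fun s => m * Real.exp (μ * s)
        + K * (Real.exp s * ((2 * s) ^ (n + 1) / (n + 1).factorial))) ?_ hB ?_
    · refine key.trans_eq ?_
      have e2 : Real.exp (-T) * Real.exp T = 1 := by rw [← Real.exp_add]; simp
      have e3 : Real.exp (-lam * T) = Real.exp (-T) * Real.exp (κ / 4 * T) * Real.exp (μ * T) := by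
        rw [← Real.exp_add, ← Real.exp_add, hlam]; ring_nf
      rw [hm, hpow, e3]
      linear_combination (K * ((2 * T) ^ (n + 1) / (n + 1).factorial)) * e2
    · have := h0 (ξ * Real.exp (T / 4))
      rw [abs_mul, abs_of_pos (Real.exp_pos _)] at this
      simpa using this
    · intro s hs _
      set ζ := ξ * Real.exp ((T - s) / 4) / 2 with hζ
      have hr' : 0 ≤ (2 * s) ^ (n + 1) / ((n + 1).factorial : ℝ) := by positivity
      have e1 : |ζ| ^ κ = |ξ| ^ κ * Real.exp (κ / 4 * (T - s)) * 2 ^ (-κ) := by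
        rw [hζ, abs_div, abs_mul, abs_of_pos (Real.exp_pos _), abs_two,
          Real.div_rpow (by positivity) (by norm_num), hpow, Real.rpow_neg (by norm_num),
          div_eq_mul_inv]
      have e2 : μ = 2 * 2 ^ (-κ) := by
        rw [hμ, sub_eq_add_neg, Real.rpow_add (by norm_num), Real.rpow_one]
      have e3 : Real.exp s * (M * |ζ| ^ κ * Real.exp (-lam * s)) * 2 = m * Real.exp (μ * s) * μ := by
        rw [e1, hm, hpow]
        have : Real.exp s * Real.exp (κ / 4 * (T - s)) * Real.exp (-lam * s)
            = Real.exp (κ / 4 * T) * Real.exp (μ * s) := by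
          rw [← Real.exp_add, ← Real.exp_add, ← Real.exp_add, hlam]; ring_nf
        linear_combination (M * |ξ| ^ κ * 2 ^ (-κ) * 2) * this
          - (M * |ξ| ^ κ * Real.exp (κ / 4 * T) * Real.exp (μ * s)) * e2
      have hexp := Real.exp_pos s
      have h4 := (hN s ζ hs).trans (mul_le_mul_of_nonneg_left (ih s ζ hs) (by norm_num))
      have h5 := mul_le_mul_of_nonneg_left h4 hexp.le
      have h6 : 0 ≤ K * (Real.exp s * ((2 * s) ^ (n + 1) / ((n + 1).factorial : ℝ))) := by positivity
      simp only [id, mul_one]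
      nlinarith

/-- The high-frequency bound. The initial datum enters through the series of the pure gain-transport
flow with small gain `δ`; the low frequencies act as a source, whose contribution is dominated by the
barrier `e^{-σt} (1 + ξ²)^{-p}`. -/
lemma IsTransported.norm_le_series {W N : ℝ → ℝ → ℂ} (h : IsTransported W N) {K : ℝ}
    (hK : ∀ t ξ, 0 ≤ t → ‖W t ξ‖ ≤ K) {δ D R σ : ℝ} {p : ℕ} (hδ : 0 ≤ δ) (hD : 0 ≤ D)
    (hδp : δ * 4 ^ p ≤ 1 / 4) (hσ : σ ≤ 1 / 2)
    (hhigh : ∀ t ξ, 0 ≤ t → R < |ξ| → ‖N t ξ‖ ≤ δ * ‖W t ξ‖)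
    (hlow : ∀ t ξ, 0 ≤ t → |ξ| ≤ R → ‖N t ξ‖ ≤ D * Real.exp (-σ * t))
    (n : ℕ) {t : ℝ} (ht : 0 ≤ t) (ξ : ℝ) :
    ‖W t ξ‖ ≤ (∑ j ∈ Finset.range n, Real.exp (-t) * ((δ * t) ^ j / j.factorial)
        * ‖W 0 (ξ * Real.exp (t / 4) / 2 ^ j)‖)
      + 4 * D * (1 + 4 * R ^ 2) ^ p * Real.exp (-σ * t) * ((1 + ξ ^ 2) ^ p)⁻¹
      + K * ((δ * t) ^ n / n.factorial) := by
  have hK0 : 0 ≤ K := (norm_nonneg _).trans (hK 0 0 le_rfl)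
  induction n generalizing t ξ with
  | zero =>
    simp only [Finset.range_zero, Finset.sum_empty, zero_add, pow_zero, Nat.factorial_zero,
      Nat.cast_one, div_one, mul_one]
    have : 0 ≤ 4 * D * (1 + 4 * R ^ 2) ^ p * Real.exp (-σ * t) * ((1 + ξ ^ 2) ^ p)⁻¹ := by
      positivity
    linarith [hK t ξ ht]
  | succ n ih =>
    set T := t with hTt
    set A := 4 * D * (1 + 4 * R ^ 2) ^ p with hA
    have hA0 : 0 ≤ A := by positivity
    set q := ((1 + ξ ^ 2) ^ p)⁻¹ with hq
    have hq0 : 0 < q := by positivity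
    set w : ℕ → ℝ := fun j => ‖W 0 (ξ * Real.exp (T / 4) / 2 ^ j)‖ with hw
    have hB : ∀ s, HasDerivAt (fun s => (∑ j ∈ Finset.range n,
          (δ * s) ^ (j + 1) / (j + 1).factorial * w (j + 1)) + w 0
        + A * q * Real.exp ((1 - σ) * s)
        + K * (Real.exp s * ((δ * s) ^ (n + 1) / (n + 1).factorial))) _ s := fun s =>
      ((((HasDerivAt.fun_sum fun j _ =>
        (hasDerivAt_pow_div_factorial δ s j).mul_const (w (j + 1))).add_const (w 0)).add
        (((hasDerivAt_id s).const_mul (1 - σ)).exp.const_mul (A * q))).add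
        (((Real.hasDerivAt_exp s).mul (hasDerivAt_pow_div_factorial δ s n)).const_mul K))
    have key := h.norm_le ht ξ (B := fun s => (∑ j ∈ Finset.range n,
          (δ * s) ^ (j + 1) / (j + 1).factorial * w (j + 1)) + w 0
        + A * q * Real.exp ((1 - σ) * s)
        + K * (Real.exp s * ((δ * s) ^ (n + 1) / (n + 1).factorial))) ?_ hB ?_
    · refine key.trans_eq ?_
      have e2 : Real.exp (-T) * Real.exp T = 1 := by rw [← Real.exp_add]; simp
      have e3 : Real.exp (-T) * Real.exp ((1 - σ) * T) = Real.exp (-σ * T) := by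
        rw [← Real.exp_add]; ring_nf
      have e4 : ∑ j ∈ Finset.range (n + 1), Real.exp (-T) * ((δ * T) ^ j / j.factorial) * w j
          = Real.exp (-T) * ((∑ j ∈ Finset.range n,
            (δ * T) ^ (j + 1) / (j + 1).factorial * w (j + 1)) + w 0) := by
        rw [Finset.sum_range_succ', mul_add, Finset.mul_sum]
        simp [mul_assoc]
      rw [e4]
      linear_combination (A * q) * e3 + (K * ((δ * T) ^ (n + 1) / (n + 1).factorial)) * e2
    · have : 0 ≤ A * q := by positivity
      simp [hw]
      linarith
    · intro s hs hsT
      set ζ := ξ * Real.exp ((T - s) / 4) / 2 with hζ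
      have hr' : 0 ≤ (δ * s) ^ (n + 1) / ((n + 1).factorial : ℝ) := by positivity
      -- the characteristic moves inwards, so `|ξ| ≤ 2 |ζ|`
      have hge : ξ ^ 2 ≤ 4 * ζ ^ 2 := by
        have h1 : 1 ≤ Real.exp ((T - s) / 4) := Real.one_le_exp (by linarith)
        have h2 : 4 * ζ ^ 2 = ξ ^ 2 * Real.exp ((T - s) / 4) ^ 2 := by rw [hζ]; ring
        rw [h2]
        exact le_mul_of_one_le_right (sq_nonneg _) (one_le_pow₀ h1)
      have hexp := Real.exp_pos s
      have hes : Real.exp s * Real.exp (-σ * s) = Real.exp ((1 - σ) * s) := by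
        rw [← Real.exp_add]; ring_nf
      have hsum0 : 0 ≤ ∑ j ∈ Finset.range n, δ * ((δ * s) ^ j / j.factorial) * w (j + 1) :=
        Finset.sum_nonneg fun j _ => mul_nonneg (by positivity) (norm_nonneg _)
      have hrem : 0 ≤ K * (Real.exp s * ((δ * s) ^ (n + 1) / ((n + 1).factorial : ℝ))) := by
        positivity
      have hrem2 : 0 ≤ K * (Real.exp s * (δ * ((δ * s) ^ n / (n.factorial : ℝ)))) := by
        positivity
      have hE := Real.exp_pos ((1 - σ) * s)
      simp only [id, mul_one]
      rcases le_or_gt |ζ| R with hR | hR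
      · have h1 := mul_le_mul_of_nonneg_left (hlow s ζ hs hR) hexp.le
        have h2 : D * 2 ≤ A * q := by
          have h3 : (1 + ξ ^ 2) ^ p ≤ (1 + 4 * R ^ 2) ^ p := by
            have : ζ ^ 2 ≤ R ^ 2 := sq_le_sq' (abs_le.1 hR).1 (abs_le.1 hR).2
            gcongr
            linarith
          rw [hq, ← div_eq_mul_inv, le_div_iff₀ (by positivity), hA]
          calc D * 2 * (1 + ξ ^ 2) ^ p ≤ D * 4 * (1 + 4 * R ^ 2) ^ p := by gcongr; norm_num
            _ = _ := by ring
        have h4 : D * Real.exp ((1 - σ) * s) ≤ A * q * (Real.exp ((1 - σ) * s) * (1 - σ)) := by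
          have : D ≤ A * q * (1 - σ) := by nlinarith
          nlinarith
        have h5 : Real.exp s * (D * Real.exp (-σ * s)) = D * Real.exp ((1 - σ) * s) := by
          rw [← hes]; ring
        linarith
      · have h1 := mul_le_mul_of_nonneg_left
          ((hhigh s ζ hs hR).trans (mul_le_mul_of_nonneg_left (ih hs ζ) hδ)) hexp.le
        have hqζ : ((1 + ζ ^ 2) ^ p)⁻¹ ≤ 4 ^ p * q := by
          rw [hq, ← div_eq_mul_inv, inv_eq_one_div, div_le_div_iff₀ (by positivity) (by positivity),
            one_mul, ← mul_pow]
          gcongr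
          linarith
        have e1 : ∑ j ∈ Finset.range n, Real.exp (-s) * ((δ * s) ^ j / j.factorial)
            * ‖W 0 (ζ * Real.exp (s / 4) / 2 ^ j)‖
            = Real.exp (-s) * ∑ j ∈ Finset.range n, ((δ * s) ^ j / j.factorial) * w (j + 1) := by
          rw [Finset.mul_sum]
          refine Finset.sum_congr rfl fun j _ => ?_
          have : ζ * Real.exp (s / 4) / 2 ^ j = ξ * Real.exp (T / 4) / 2 ^ (j + 1) := by
            have : Real.exp (T / 4) = Real.exp ((T - s) / 4) * Real.exp (s / 4) := by
              rw [← Real.exp_add]; ring_nf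
            rw [hζ, this, pow_succ]; field_simp
          rw [this, hw]; ring
        have e2 : ∑ j ∈ Finset.range n, δ * ((δ * s) ^ j / j.factorial) * w (j + 1)
            = δ * ∑ j ∈ Finset.range n, ((δ * s) ^ j / j.factorial) * w (j + 1) := by
          rw [Finset.mul_sum]
          exact Finset.sum_congr rfl fun j _ => by ring
        have e3 : Real.exp s * Real.exp (-s) = 1 := by rw [← Real.exp_add]; simp
        rw [e1] at h1
        rw [e2]
        have h6 : δ * (A * Real.exp ((1 - σ) * s) * ((1 + ζ ^ 2) ^ p)⁻¹)
            ≤ A * q * (Real.exp ((1 - σ) * s) * (1 - σ)) := by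
          calc _ ≤ δ * (A * Real.exp ((1 - σ) * s) * (4 ^ p * q)) := by gcongr
            _ = (A * q * Real.exp ((1 - σ) * s)) * (δ * 4 ^ p) := by ring
            _ ≤ (A * q * Real.exp ((1 - σ) * s)) * (1 - σ) := by
                gcongr
                linarith
            _ = _ := by ring
        have h7 : Real.exp s * (δ * (Real.exp (-s) * (∑ j ∈ Finset.range n,
              ((δ * s) ^ j / j.factorial) * w (j + 1)) + A * Real.exp (-σ * s) * ((1 + ζ ^ 2) ^ p)⁻¹
              + K * ((δ * s) ^ n / n.factorial)))
            = δ * (∑ j ∈ Finset.range n, ((δ * s) ^ j / j.factorial) * w (j + 1))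
              + δ * (A * Real.exp ((1 - σ) * s) * ((1 + ζ ^ 2) ^ p)⁻¹)
              + K * (Real.exp s * (δ * ((δ * s) ^ n / n.factorial))) := by
          rw [← hes]
          linear_combination (δ * ∑ j ∈ Finset.range n,
            ((δ * s) ^ j / j.factorial) * w (j + 1)) * e3
        rw [h7] at h1
        linarith

/-! ### Plancherel's theorem for integrable functions -/

section Plancherel

open SchwartzMap FourierTransform

lemma mathlib_fourier_eq (f : ℝ → ℝ) (v : ℝ) :
    FourierTransform.fourier (fun x : ℝ => (f x : ℂ)) v = Boltzmann1D.fourier f (2 * Real.pi * v) := by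
  rw [Real.fourier_real_eq_integral_exp_smul, Boltzmann1D.fourier]
  congr 1 with x
  rw [smul_eq_mul, mul_comm]
  congr 2
  push_cast; ring

lemma continuous_fourier {f : ℝ → ℝ} (hf : Integrable f) : Continuous (Boltzmann1D.fourier f) := by
  have h : Continuous (FourierTransform.fourier (fun x : ℝ => (f x : ℂ))) :=
    VectorFourier.fourierIntegral_continuous Real.continuous_fourierChar
      (by exact continuous_inner) hf.ofReal
  have h2 : Boltzmann1D.fourier f = fun ξ => FourierTransform.fourier (fun x : ℝ => (f x : ℂ))
      ((2 * Real.pi)⁻¹ * ξ) := by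
    ext ξ
    rw [mathlib_fourier_eq]
    congr 1
    have := Real.pi_pos
    field_simp
  rw [h2]
  fun_prop

/-- An integrable function whose Fourier transform is square integrable is itself square
integrable: its Fourier transform is that of some `u ∈ L²`, and `u = f` as distributions. -/
lemma memLp_two_of_fourier {f : ℝ → ℝ} (hf : Integrable f)
    (h2 : MemLp (Boltzmann1D.fourier f) 2) : MemLp f 2 := by
  set F : ℝ → ℂ := fun x => (f x : ℂ) with hF
  have hFi : Integrable F := hf.ofReal
  have hpi := Real.pi_pos
  have hG : MemLp (FourierTransform.fourier F) 2 := by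
    have hc : Continuous (FourierTransform.fourier F) := by
      have := continuous_fourier hf
      rw [show FourierTransform.fourier F = fun v => Boltzmann1D.fourier f (2 * Real.pi * v) from
        funext (mathlib_fourier_eq f)]
      fun_prop
    rw [memLp_two_iff_integrable_sq_norm hc.aestronglyMeasurable]
    rw [memLp_two_iff_integrable_sq_norm (continuous_fourier hf).aestronglyMeasurable] at h2
    refine (h2.comp_mul_left' (by positivity : (2 * Real.pi) ≠ 0)).congr (ae_of_all _ fun v => ?_)
    simp only [hF, mathlib_fourier_eq]
  set G : Lp ℂ 2 (volume : Measure ℝ) := hG.toLp _ with hGdef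
  set u : Lp ℂ 2 (volume : Measure ℝ) := 𝓕⁻ G with hu
  have huG : 𝓕 (u : 𝓢'(ℝ, ℂ)) = (G : 𝓢'(ℝ, ℂ)) := by
    rw [Lp.fourier_toTemperedDistribution_eq, hu, FourierTransform.fourier_fourierInv_eq]
  have key : ∀ φ : 𝓢(ℝ, ℂ), ∫ x, φ x • u x = ∫ x, φ x • F x := by
    intro φ
    have h1 := congrArg (fun T : 𝓢'(ℝ, ℂ) => T (𝓕⁻ φ)) huG
    simp only [TemperedDistribution.fourier_apply, Lp.toTemperedDistribution_apply,
      FourierTransform.fourier_fourierInv_eq] at h1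
    rw [h1]
    have h3 : ∫ x, (𝓕⁻ φ) x • G x = ∫ x, (𝓕⁻ φ) x • FourierTransform.fourier F x := by
      refine integral_congr_ae ?_
      filter_upwards [hG.coeFn_toLp] with x hx
      rw [hGdef, hx]
    rw [h3]
    have h4 := VectorFourier.integral_fourierIntegral_smul_eq_flip (L := innerₗ ℝ)
      (μ := volume) (ν := volume) (f := (𝓕⁻ φ : 𝓢(ℝ, ℂ))) (g := F)
      Real.continuous_fourierChar (by exact continuous_inner) (𝓕⁻ φ : 𝓢(ℝ, ℂ)).integrable hFi
    rw [flip_innerₗ] at h4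
    have h5 : FourierTransform.fourier ((𝓕⁻ φ : 𝓢(ℝ, ℂ)) : ℝ → ℂ) = φ := by
      rw [← SchwartzMap.fourier_coe, FourierTransform.fourier_fourierInv_eq]
    calc _ = ∫ x, FourierTransform.fourier ((𝓕⁻ φ : 𝓢(ℝ, ℂ)) : ℝ → ℂ) x • F x := h4.symm
      _ = _ := by rw [h5]
  have hae : ∀ᵐ x, u x = F x := by
    refine ae_eq_of_integral_contDiff_smul_eq ((Lp.memLp u).locallyIntegrable (by norm_num))
      hFi.locallyIntegrable fun φ hφ hc => ?_
    have hg₁ : HasCompactSupport (Complex.ofRealCLM ∘ φ) := hc.comp_left rfl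
    have hg₂ : ContDiff ℝ (⊤ : ℕ∞) (Complex.ofRealCLM ∘ φ) := by fun_prop
    simpa using key (hg₁.toSchwartzMap hg₂)
  have hFL : MemLp F 2 := (memLp_congr_ae hae).1 (Lp.memLp u)
  refine hFL.re.congr_norm hf.1 (ae_of_all _ fun x => ?_)
  simp [hF]

end Plancherel

/-! ### Uniform smallness at high frequencies -/

/-- A pointwise bound by a negative power is dominated by some barrier `d + (1 - d) steady (a ·)`. -/
lemma exists_barrier {β c d : ℝ} (hβ : 0 < β) (hc : 0 < c) (hd : 0 < d) (hd1 : d ≤ 1) :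
    ∃ a : ℝ, 0 < a ∧ ∀ ξ : ℝ,
      (1 + c ^ 2 * |ξ| ^ 2) ^ (-(β / 2)) ≤ d + (1 - d) * steady (a * ξ) := by
  obtain ⟨R, hR0, hR⟩ : ∃ R : ℝ, 0 < R ∧ ∀ r, R ≤ r → (1 + c ^ 2 * r ^ 2) ^ (-(β / 2)) ≤ d := by
    have h1 : Tendsto (fun r : ℝ => 1 + c ^ 2 * r ^ 2) atTop atTop :=
      tendsto_atTop_add_const_left _ _ ((tendsto_pow_atTop two_ne_zero).const_mul_atTop (by positivity))
    have h2 := (tendsto_rpow_neg_atTop (half_pos hβ)).comp h1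
    obtain ⟨R, hR⟩ := eventually_atTop.1 (h2.eventually (eventually_le_nhds hd))
    exact ⟨max R 1, by positivity, fun r hr => hR r ((le_max_left _ _).trans hr)⟩
  -- On `|ξ| ≤ R` the left-hand side is at most `1 / (1 + ν ξ²)`, and `steady (a ξ) ≥ 1 - a² ξ²`.
  set ν := β / 2 * c ^ 2 / (1 + c ^ 2 * R ^ 2) with hν
  have hν0 : 0 < ν := by positivity
  set a2 := ν / (1 + ν * R ^ 2) with ha2
  have ha20 : 0 < a2 := by positivity
  refine ⟨√a2, Real.sqrt_pos.2 ha20, fun ξ => ?_⟩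
  rcases le_or_gt R |ξ| with h | h
  · have := (steady_pos (√a2 * ξ)).le
    have h3 : 0 ≤ (1 - d) * steady (√a2 * ξ) := mul_nonneg (by linarith) this
    linarith [hR _ h]
  · rw [sq_abs]
    have hξ : ξ ^ 2 ≤ R ^ 2 := by rw [← sq_abs ξ]; gcongr
    have hsq : (√a2 * |ξ|) ^ 2 = a2 * ξ ^ 2 := by
      rw [mul_pow, Real.sq_sqrt ha20.le, sq_abs]
    have hst : 1 - a2 * ξ ^ 2 ≤ steady (√a2 * ξ) := by
      unfold steady
      rw [abs_mul, abs_of_nonneg (Real.sqrt_nonneg _), ← hsq]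
      set r := √a2 * |ξ|
      have hr : 0 ≤ r := by positivity
      have := Real.add_one_le_exp (-r)
      nlinarith
    have hle : 1 / (1 + ν * ξ ^ 2) ≤ 1 - a2 * ξ ^ 2 := by
      rw [div_le_iff₀ (by positivity)]
      have h1 : a2 * (1 + ν * R ^ 2) = ν := by rw [ha2]; field_simp
      have h2 : a2 * (1 + ν * ξ ^ 2) ≤ ν :=
        le_trans (by gcongr) h1.le
      nlinarith [mul_le_mul_of_nonneg_right h2 (sq_nonneg ξ)]
    have hpow : (1 + c ^ 2 * ξ ^ 2) ^ (-(β / 2)) ≤ 1 / (1 + ν * ξ ^ 2) := by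
      have hp : 0 < 1 + c ^ 2 * ξ ^ 2 := by positivity
      rw [Real.rpow_neg hp.le, ← one_div]
      apply one_div_le_one_div_of_le (by positivity)
      rw [Real.rpow_def_of_pos hp]
      refine le_trans ?_ (Real.add_one_le_exp _)
      have hlog := Real.one_sub_inv_le_log_of_pos hp
      have h1 : c ^ 2 * ξ ^ 2 / (1 + c ^ 2 * R ^ 2) ≤ 1 - (1 + c ^ 2 * ξ ^ 2)⁻¹ := by
        have : 1 - (1 + c ^ 2 * ξ ^ 2)⁻¹ = c ^ 2 * ξ ^ 2 / (1 + c ^ 2 * ξ ^ 2) := by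
          field_simp; ring
        rw [this]
        gcongr
      have h2 : ν * ξ ^ 2 = c ^ 2 * ξ ^ 2 / (1 + c ^ 2 * R ^ 2) * (β / 2) := by
        rw [hν]; ring
      rw [h2]
      have := mul_le_mul_of_nonneg_right (h1.trans hlog) (half_pos hβ).le
      linarith
    have h4 : 0 ≤ a2 * ξ ^ 2 := by positivity
    nlinarith [mul_le_mul_of_nonneg_left hst (sub_nonneg.2 hd1)]

lemma tendsto_steady : Tendsto steady atTop (𝓝 0) := by
  have h0 := Real.tendsto_pow_mul_exp_neg_atTop_nhds_zero 0
  have h1 := Real.tendsto_pow_mul_exp_neg_atTop_nhds_zero 1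
  have := h0.add h1
  rw [add_zero] at this
  refine this.congr' ?_
  filter_upwards [eventually_ge_atTop 0] with x hx
  simp only [steady, abs_of_nonneg hx]
  ring

/-- The high frequencies of a solution are uniformly small, with a threshold that depends on the
initial datum only through `β` and `c`. -/
lemma exists_uniform_smallness {β c δ : ℝ} (hβ : 0 < β) (hc : 0 < c) (hδ : 0 < δ) :
    ∃ R : ℝ, 0 < R ∧ ∀ g : ℝ → ℝ → ℝ, IsSolution g → ∫ x, g 0 x = 1 →
      (∀ ξ : ℝ, ‖fourier (g 0) ξ‖ ≤ (1 + c ^ 2 * |ξ| ^ 2) ^ (-(β / 2))) →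
      ∀ t ξ, 0 ≤ t → R < |ξ| → ‖fourier (g t) ξ‖ + steady ξ ≤ δ := by
  set d := min (δ / 3) 1 with hd
  have hd0 : 0 < d := by positivity
  have hd3 : d ≤ δ / 3 := min_le_left _ _
  obtain ⟨a, ha, hbar⟩ := exists_barrier hβ hc hd0 (min_le_right _ _)
  obtain ⟨R, hR⟩ := eventually_atTop.1
    (tendsto_steady.eventually (eventually_le_nhds (by positivity : 0 < δ / 3)))
  refine ⟨max 1 (max R (R / a)), by positivity, fun g hg h0 hF t ξ ht hξ => ?_⟩
  have h1 := (hg.isTransported h0).norm_le_barrier (fun t ξ ht => hg.norm_fourier_le_one h0 ht ξ)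
    hd0.le (min_le_right _ _) (fun ξ => (hF ξ).trans (hbar ξ)) ht ξ
  have hR1 : R ≤ |ξ| := ((le_max_left _ _).trans (le_max_right _ _)).trans hξ.le
  have hR2 : R ≤ |a * ξ| := by
    rw [abs_mul, abs_of_pos ha, ← div_le_iff₀' ha]
    exact ((le_max_right _ _).trans (le_max_right _ _)).trans hξ.le
  have h2 := hR _ hR1
  have h3 := hR _ hR2
  rw [steady_abs] at h2 h3
  nlinarith [mul_nonneg hd0.le (steady_pos (a * ξ)).le]

/-! ### The Fourier transform near the origin -/

lemma norm_exp_sub_taylor_le {κ : ℝ} (hκ : 2 ≤ κ) (hκ' : κ ≤ 3) (θ : ℝ) :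
    ‖Complex.exp (-(Complex.I * θ)) - (1 - Complex.I * θ - (θ : ℂ) ^ 2 / 2)‖ ≤ 4 * |θ| ^ κ := by
  have hn : ‖-(Complex.I * (θ : ℂ))‖ = |θ| := by simp
  have he1 : ‖Complex.exp (-(Complex.I * θ))‖ = 1 := by
    have := exp_char_norm θ 1
    simpa using this
  rcases le_total |θ| 1 with h | h
  · have h1 := Complex.norm_exp_sub_sum_le_norm_mul_exp (-(Complex.I * θ)) 3
    have h2 : ∑ m ∈ Finset.range 3, (-(Complex.I * (θ : ℂ))) ^ m / (m.factorial : ℂ)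
        = 1 - Complex.I * θ - (θ : ℂ) ^ 2 / 2 := by
      simp [Finset.sum_range_succ, Nat.factorial]
      rw [mul_pow, Complex.I_sq]; ring
    rw [h2, hn] at h1
    have h3 : |θ| ^ 3 ≤ |θ| ^ κ := by
      rcases (abs_nonneg θ).eq_or_lt' with h0 | h0
      · rw [h0, Real.zero_rpow (by linarith)]; norm_num
      · rw [← Real.rpow_natCast]
        exact Real.rpow_le_rpow_of_exponent_ge h0 h (by exact_mod_cast hκ')
    have h4 : Real.exp |θ| ≤ 4 :=
      (Real.exp_le_exp.2 h).trans (by linarith [Real.exp_one_lt_d9])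
    calc _ ≤ |θ| ^ 3 * Real.exp |θ| := h1
      _ ≤ |θ| ^ κ * 4 := by gcongr
      _ = _ := by ring
  · have h3 : |θ| ^ 2 ≤ |θ| ^ κ := by
      rw [← Real.rpow_natCast]
      exact Real.rpow_le_rpow_of_exponent_le h (by exact_mod_cast hκ)
    have h5 : ‖(1 - Complex.I * θ - (θ : ℂ) ^ 2 / 2)‖ ≤ 1 + |θ| + |θ| ^ 2 / 2 := by
      refine (norm_sub_le _ _).trans (add_le_add ((norm_sub_le _ _).trans ?_) ?_)
      · simp
      · simp
    refine (norm_sub_le _ _).trans ?_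
    rw [he1]
    nlinarith

lemma integrable_weight {f : ℝ → ℝ} (hf : AEStronglyMeasurable f) {k : ℝ}
    (h : weightedL1Norm k f ≠ ⊤) : Integrable (fun x => |f x| * (1 + |x|) ^ k) := by
  have hm : AEStronglyMeasurable (fun x => |f x| * (1 + |x|) ^ k) := by
    refine (hf.norm).mul (Continuous.aestronglyMeasurable ?_)
    exact Continuous.rpow_const (by fun_prop) fun x => Or.inl (by positivity)
  refine ⟨hm, ?_⟩
  rw [hasFiniteIntegral_iff_ofReal (ae_of_all _ fun x => by positivity)]
  exact h.lt_top

lemma integrable_mul_of_weight_sq {f p : ℝ → ℝ} (hf0 : Integrable f)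
    (hf : Integrable (fun x : ℝ => (1 + |x|) ^ 2 * f x)) (hp : Continuous p)
    (hpb : ∀ x, |p x| ≤ (1 + |x|) ^ 2) : Integrable (fun x => p x * f x) := by
  refine hf.mono (hp.aestronglyMeasurable.mul hf0.1) (ae_of_all _ fun x => ?_)
  rw [norm_mul, norm_mul]
  exact mul_le_mul_of_nonneg_right ((hpb x).trans (le_abs_self _)) (norm_nonneg _)

/-- A function with vanishing moments of order `0, 1, 2` has a Fourier transform of order
`|ξ|^κ` at the origin. -/
lemma norm_fourier_le_of_moments {f : ℝ → ℝ} {κ k : ℝ} (hκ : 2 ≤ κ) (hκ' : κ ≤ 3) (hk : κ ≤ k)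
    (hf : Integrable (fun x => (1 + |x|) ^ 2 * f x)) (hf0 : Integrable f)
    (m0 : ∫ x, f x = 0) (m1 : ∫ x, x * f x = 0) (m2 : ∫ x, x ^ 2 * f x = 0)
    (h : weightedL1Norm k f ≠ ⊤) (ξ : ℝ) :
    ‖fourier f ξ‖ ≤ 4 * (weightedL1Norm k f).toReal * |ξ| ^ κ := by
  have hw := integrable_weight hf0.1 h
  have hwI : (weightedL1Norm k f).toReal = ∫ x, |f x| * (1 + |x|) ^ k := by
    rw [integral_eq_lintegral_of_nonneg_ae (ae_of_all _ fun x => by positivity) hw.1]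
    rfl
  have i1 := integrable_mul_of_weight_sq hf0 hf (p := fun x => x) continuous_id (fun x => by nlinarith [abs_nonneg x])
  have i2 := integrable_mul_of_weight_sq hf0 hf (p := fun x => x ^ 2) (by fun_prop)
    (fun x => by rw [abs_pow]; nlinarith [abs_nonneg x])
  have e : (fun x : ℝ => (f x : ℂ) * (1 - Complex.I * (x * ξ : ℝ) - ((x * ξ : ℝ) : ℂ) ^ 2 / 2))
      = fun x => (f x : ℂ) - ((x * f x : ℝ) : ℂ) * (Complex.I * ξ)
        - ((x ^ 2 * f x : ℝ) : ℂ) * ((ξ : ℂ) ^ 2 / 2) := by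
    ext x; push_cast; ring
  have j0 : Integrable (fun x => (f x : ℂ)) := hf0.ofReal
  have j1 : Integrable (fun x => ((x * f x : ℝ) : ℂ) * (Complex.I * ξ)) := i1.ofReal.mul_const _
  have j2 : Integrable (fun x => ((x ^ 2 * f x : ℝ) : ℂ) * ((ξ : ℂ) ^ 2 / 2)) :=
    i2.ofReal.mul_const _
  have j01 : Integrable (fun x => (f x : ℂ) - ((x * f x : ℝ) : ℂ) * (Complex.I * ξ)) := j0.sub j1
  have hT : ∫ x, (f x : ℂ) * (1 - Complex.I * (x * ξ : ℝ) - ((x * ξ : ℝ) : ℂ) ^ 2 / 2) = 0 := by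
    rw [e, integral_sub j01 j2, integral_sub j0 j1, integral_mul_const, integral_mul_const,
      integral_complex_ofReal, integral_complex_ofReal, integral_complex_ofReal, m0, m1, m2]
    simp
  have hTi : Integrable (fun x : ℝ =>
      (f x : ℂ) * (1 - Complex.I * (x * ξ : ℝ) - ((x * ξ : ℝ) : ℂ) ^ 2 / 2)) := by
    rw [e]
    exact j01.sub j2
  rw [← sub_zero (fourier f ξ), ← hT, fourier, ← integral_sub (integrable_mul_char hf0 ξ) hTi, hwI,
    mul_right_comm, ← integral_const_mul]
  refine norm_integral_le_of_norm_le (hw.const_mul _) (ae_of_all _ fun x => ?_)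
  have h1 := norm_exp_sub_taylor_le hκ hκ' (x * ξ)
  have h2 : |x * ξ| ^ κ ≤ (1 + |x|) ^ k * |ξ| ^ κ := by
    rw [abs_mul, Real.mul_rpow (abs_nonneg _) (abs_nonneg _)]
    gcongr
    calc |x| ^ κ ≤ (1 + |x|) ^ κ := by gcongr; linarith
      _ ≤ (1 + |x|) ^ k := Real.rpow_le_rpow_of_exponent_le (by linarith [abs_nonneg x]) hk
  rw [← mul_sub, norm_mul, Complex.norm_real, Real.norm_eq_abs]
  have e3 : -(Complex.I * x * ξ) = -(Complex.I * (x * ξ : ℝ)) := by push_cast; ring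
  rw [e3]
  calc _ ≤ |f x| * (4 * ((1 + |x|) ^ k * |ξ| ^ κ)) := by gcongr; linarith
    _ = _ := by ring

/-! ### Sobolev norms as weighted `L²` norms -/

/-- The measure `(1 + ξ²)^s dξ`: the Sobolev norm of `f` is the `L²` norm of the Fourier transform of
`f` with respect to it. -/
noncomputable def sobolevMeasure (s : ℝ) : Measure ℝ :=
  volume.withDensity fun ξ => ENNReal.ofReal ((1 + |ξ| ^ 2) ^ s)

lemma continuous_sobolevWeight (s : ℝ) : Continuous fun ξ : ℝ => (1 + |ξ| ^ 2) ^ s :=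
  Continuous.rpow_const (by fun_prop) fun ξ => Or.inl (by positivity)

lemma eLpNorm_sobolevMeasure {E : Type*} [NormedAddCommGroup E] (s : ℝ) {F : ℝ → E}
    (hF : Continuous F) : eLpNorm F 2 (sobolevMeasure s)
      = (∫⁻ ξ : ℝ, ENNReal.ofReal ((1 + |ξ| ^ 2) ^ s * ‖F ξ‖ ^ 2)) ^ (1 / 2 : ℝ) := by
  rw [eLpNorm_eq_lintegral_rpow_enorm_toReal two_ne_zero ENNReal.ofNat_ne_top, sobolevMeasure,
    lintegral_withDensity_eq_lintegral_mul _
      (continuous_sobolevWeight s).measurable.ennreal_ofReal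
      (by have := hF.enorm.measurable; fun_prop)]
  simp only [ENNReal.toReal_ofNat]
  congr 1
  refine lintegral_congr fun ξ => ?_
  rw [ENNReal.ofReal_mul (by positivity), Pi.mul_apply, ENNReal.ofReal_pow (norm_nonneg _),
    ofReal_norm]
  norm_num

lemma sobolevNorm_eq {f : ℝ → ℝ} (hf : Integrable f) (s : ℝ) :
    sobolevNorm s f = eLpNorm (fourier f) 2 (sobolevMeasure s) :=
  (eLpNorm_sobolevMeasure s (continuous_fourier hf)).symm

/-- Dilation in the `H^s` norm: the Jacobian costs `b⁻¹`, and `m ≥ max 1 b⁻¹` bounds the ratio of the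
weights `1 + ξ² ≤ m² (1 + (ξ b)²)`. -/
lemma eLpNorm_comp_mul_le {E : Type*} [NormedAddCommGroup E] {s : ℝ} (hs : 0 ≤ s) {F : ℝ → E}
    (hF : Continuous F) {b m A : ℝ} (hb : 0 < b) (hm : 1 ≤ m) (hmb : 1 ≤ m * b) (hA : 0 ≤ A)
    (hbA : b⁻¹ * (m ^ 2) ^ s = A ^ 2) :
    eLpNorm (fun ξ => F (ξ * b)) 2 (sobolevMeasure s)
      ≤ ENNReal.ofReal A * eLpNorm F 2 (sobolevMeasure s) := by
  rw [eLpNorm_sobolevMeasure s (by fun_prop), eLpNorm_sobolevMeasure s hF]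
  have hsq : ENNReal.ofReal A = ENNReal.ofReal (A ^ 2) ^ (1 / 2 : ℝ) := by
    rw [ENNReal.ofReal_rpow_of_nonneg (by positivity) (by norm_num), ← Real.sqrt_eq_rpow,
      Real.sqrt_sq hA]
  rw [hsq, ← ENNReal.mul_rpow_of_nonneg _ _ (by norm_num)]
  gcongr
  set G : ℝ → ℝ≥0∞ := fun ζ => ENNReal.ofReal ((1 + |ζ| ^ 2) ^ s * ‖F ζ‖ ^ 2) with hG
  have hGm : Measurable G :=
    ((continuous_sobolevWeight s).mul (by fun_prop)).measurable.ennreal_ofReal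
  have hscale : ∫⁻ ξ, G (ξ * b) = ENNReal.ofReal b⁻¹ * ∫⁻ ζ, G ζ := by
    have := Real.map_volume_mul_right hb.ne'
    rw [← lintegral_map hGm (measurable_mul_const b), this, lintegral_smul_measure,
      abs_of_pos (by positivity)]
    rfl
  calc ∫⁻ ξ, ENNReal.ofReal ((1 + |ξ| ^ 2) ^ s * ‖F (ξ * b)‖ ^ 2)
      ≤ ∫⁻ ξ, ENNReal.ofReal ((m ^ 2) ^ s) * G (ξ * b) := by
        refine lintegral_mono fun ξ => ?_
        rw [hG, ← ENNReal.ofReal_mul (by positivity)]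
        refine ENNReal.ofReal_le_ofReal ?_
        rw [← mul_assoc, ← Real.mul_rpow (by positivity) (by positivity)]
        gcongr
        rw [sq_abs, sq_abs]
        have h1 : 1 ≤ m ^ 2 := one_le_pow₀ hm
        have h2 : 1 ≤ (m * b) ^ 2 := one_le_pow₀ hmb
        have h3 : ξ ^ 2 * 1 ≤ ξ ^ 2 * (m * b) ^ 2 := by gcongr
        nlinarith
    _ = ENNReal.ofReal (A ^ 2) * ∫⁻ ζ, G ζ := by
        rw [lintegral_const_mul _ (by fun_prop), hscale, ← mul_assoc,
          ← ENNReal.ofReal_mul (by positivity), mul_comm _ b⁻¹, hbA]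

lemma continuous_barrier (p : ℕ) : Continuous fun ξ : ℝ => ((1 + ξ ^ 2) ^ p)⁻¹ :=
  Continuous.inv₀ (by fun_prop) fun ξ => by positivity

lemma eLpNorm_barrier_lt_top {s : ℝ} {p : ℕ} (hp : s + 1 ≤ p) :
    eLpNorm (fun ξ : ℝ => ((1 + ξ ^ 2) ^ p)⁻¹) 2 (sobolevMeasure s) < ⊤ := by
  rw [eLpNorm_sobolevMeasure s (continuous_barrier p)]
  refine ENNReal.rpow_lt_top_of_nonneg (by norm_num) (ne_of_lt ?_)
  refine lt_of_le_of_lt (lintegral_mono fun ξ => ENNReal.ofReal_le_ofReal ?_)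
    (integrable_inv_one_add_sq.lintegral_lt_top)
  have h1 : (1 : ℝ) ≤ 1 + ξ ^ 2 := by nlinarith [sq_nonneg ξ]
  have hp1 : (1 : ℝ) ≤ (1 + ξ ^ 2) ^ p := one_le_pow₀ h1
  rw [sq_abs, Real.norm_of_nonneg (by positivity)]
  have h2 : (1 + ξ ^ 2) ^ s * (1 + ξ ^ 2) ≤ (1 + ξ ^ 2) ^ p := by
    calc _ = (1 + ξ ^ 2) ^ (s + 1) := by rw [Real.rpow_add (by positivity), Real.rpow_one]
      _ ≤ (1 + ξ ^ 2) ^ (p : ℝ) := Real.rpow_le_rpow_of_exponent_le h1 hp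
      _ = _ := Real.rpow_natCast _ _
  have h3 : (1 + ξ ^ 2) ^ s * (((1 + ξ ^ 2) ^ p)⁻¹) ^ 2 * (1 + ξ ^ 2) ≤ 1 := by
    calc _ = (1 + ξ ^ 2) ^ s * (1 + ξ ^ 2) * (((1 + ξ ^ 2) ^ p)⁻¹) ^ 2 := by ring
      _ ≤ (1 + ξ ^ 2) ^ p * (((1 + ξ ^ 2) ^ p)⁻¹) ^ 2 := by gcongr
      _ = ((1 + ξ ^ 2) ^ p)⁻¹ := by field_simp
      _ ≤ 1 := inv_le_one_of_one_le₀ hp1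
  rwa [inv_eq_one_div (1 + ξ ^ 2), le_div_iff₀ (by positivity)]

/-! ### Sobolev decay -/

/-- The Sobolev estimate: the series of `IsTransported.norm_le_series` is summed in the weighted `L²`
norm by Minkowski's inequality, and the remainder disappears by Fatou's lemma. -/
lemma IsTransported.eLpNorm_le {W N : ℝ → ℝ → ℂ} (h : IsTransported W N)
    (hc : ∀ t, 0 ≤ t → Continuous (W t)) {K : ℝ}
    (hK : ∀ t ξ, 0 ≤ t → ‖W t ξ‖ ≤ K) {l δ D R σ : ℝ} {p : ℕ} (hl : 0 ≤ l) (hδ : 0 ≤ δ)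
    (hD : 0 ≤ D) (hp : l + 1 ≤ p) (hδp : δ * 4 ^ p ≤ 1 / 4) (hσ : σ ≤ 1 / 2)
    (hhigh : ∀ t ξ, 0 ≤ t → R < |ξ| → ‖N t ξ‖ ≤ δ * ‖W t ξ‖)
    (hlow : ∀ t ξ, 0 ≤ t → |ξ| ≤ R → ‖N t ξ‖ ≤ D * Real.exp (-σ * t)) {t : ℝ} (ht : 0 ≤ t) :
    eLpNorm (W t) 2 (sobolevMeasure l) ≤ ENNReal.ofReal (Real.exp (-σ * t))
      * (eLpNorm (W 0) 2 (sobolevMeasure l) + ENNReal.ofReal (4 * D * (1 + 4 * R ^ 2) ^ p)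
        * eLpNorm (fun ξ : ℝ => ((1 + ξ ^ 2) ^ p)⁻¹) 2 (sobolevMeasure l)) := by
  set μ := sobolevMeasure l
  set r : ℕ → ℝ := fun n => K * ((δ * t) ^ n / n.factorial) with hr
  set S : ℕ → ℝ → ℝ := fun j ξ => Real.exp (-t) * ((δ * t) ^ j / j.factorial)
        * ‖W 0 (ξ * (Real.exp (t / 4) / 2 ^ j))‖ with hS
  set Q : ℝ → ℝ := fun ξ => 4 * D * (1 + 4 * R ^ 2) ^ p * Real.exp (-σ * t) * ((1 + ξ ^ 2) ^ p)⁻¹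
    with hQ
  have hc0 := hc 0 le_rfl
  have hct := hc t ht
  have hSc : ∀ j, Continuous (S j) := fun j => by fun_prop
  have hQc : Continuous Q := continuous_const.mul (continuous_barrier p)
  -- `2 ^ (l + 1/2)` is the loss in the `H^l` norm under `ξ ↦ ξ / 2`
  set L : ℝ := 2 ^ (l + 1 / 2) with hL
  have hL0 : 0 < L := by positivity
  have hLp : L ≤ 4 ^ p := by
    calc L ≤ (2 : ℝ) ^ ((2 * p : ℕ) : ℝ) := by
          refine Real.rpow_le_rpow_of_exponent_le (by norm_num) ?_
          push_cast
          linarith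
      _ = 4 ^ p := by rw [Real.rpow_natCast, pow_mul]; norm_num
  have hSn : ∀ j, eLpNorm (S j) 2 μ ≤ ENNReal.ofReal
      (Real.exp (-(9 / 8) * t) * ((δ * L * t) ^ j / j.factorial)) * eLpNorm (W 0) 2 μ := by
    intro j
    have h1 := eLpNorm_comp_mul_le hl hc0 (b := Real.exp (t / 4) / 2 ^ j) (m := 2 ^ j)
      (A := Real.exp (-t / 8) * L ^ j) (by positivity) (one_le_pow₀ (by norm_num))
      (by
        rw [mul_div_cancel₀ _ (by positivity)]
        exact Real.one_le_exp (by positivity)) (by positivity)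
      (by
        have e1 : Real.exp (-t / 8) ^ 2 = (Real.exp (t / 4))⁻¹ := by
          rw [← Real.exp_neg, ← Real.exp_nat_mul]; push_cast; ring_nf
        have e2 : L ^ 2 = 2 * (2 ^ 2) ^ l := by
          calc L ^ 2 = 2 ^ (1 + 2 * l) := by
                rw [hL, ← Real.rpow_natCast, ← Real.rpow_mul (by norm_num)]
                congr 1; push_cast; ring
            _ = 2 * (2 ^ 2) ^ l := by
                rw [Real.rpow_add (by norm_num), Real.rpow_one, Real.rpow_mul (by norm_num),
                  Real.rpow_two]
        have e3 : (((2 : ℝ) ^ j) ^ 2) ^ l = ((2 ^ 2) ^ l) ^ j := by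
          rw [← pow_mul, mul_comm j 2, pow_mul, ← Real.rpow_natCast _ j, ← Real.rpow_mul (by norm_num),
            mul_comm, Real.rpow_mul (by norm_num), Real.rpow_natCast]
        rw [mul_pow, e1, e3, ← pow_mul L, mul_comm j 2, pow_mul L, e2, mul_pow, inv_div]
        field_simp)
    have h2 : S j = (Real.exp (-t) * ((δ * t) ^ j / j.factorial)) •
        fun ξ => ‖W 0 (ξ * (Real.exp (t / 4) / 2 ^ j))‖ := by
      ext ξ; simp [hS]
    rw [h2, eLpNorm_const_smul, eLpNorm_norm]
    refine (mul_le_mul_right h1 _).trans_eq ?_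
    rw [← mul_assoc, Real.enorm_of_nonneg (by positivity), ← ENNReal.ofReal_mul (by positivity)]
    congr 2
    have e4 : Real.exp (-(9 / 8) * t) = Real.exp (-t) * Real.exp (-t / 8) := by
      rw [← Real.exp_add]; ring_nf
    rw [e4, mul_pow, mul_pow, mul_pow]
    ring
  have hQn : eLpNorm Q 2 μ = ENNReal.ofReal (Real.exp (-σ * t)) *
      (ENNReal.ofReal (4 * D * (1 + 4 * R ^ 2) ^ p)
        * eLpNorm (fun ξ : ℝ => ((1 + ξ ^ 2) ^ p)⁻¹) 2 μ) := by
    have h2 : Q = (4 * D * (1 + 4 * R ^ 2) ^ p * Real.exp (-σ * t)) •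
        fun ξ => ((1 + ξ ^ 2) ^ p)⁻¹ := by
      ext ξ; simp [hQ]
    rw [h2, eLpNorm_const_smul, Real.enorm_of_nonneg (by positivity),
      ENNReal.ofReal_mul (by positivity)]
    ring
  have hbound : ∀ n, eLpNorm (fun ξ => max (‖W t ξ‖ - r n) 0) 2 μ ≤
      ENNReal.ofReal (Real.exp (-σ * t)) * (eLpNorm (W 0) 2 μ +
        ENNReal.ofReal (4 * D * (1 + 4 * R ^ 2) ^ p)
        * eLpNorm (fun ξ : ℝ => ((1 + ξ ^ 2) ^ p)⁻¹) 2 μ) := by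
    intro n
    calc eLpNorm (fun ξ => max (‖W t ξ‖ - r n) 0) 2 μ
        ≤ eLpNorm ((∑ j ∈ Finset.range n, S j) + Q) 2 μ := by
          refine eLpNorm_mono_real fun ξ => ?_
          have h1 := h.norm_le_series hK hδ hD hδp hσ hhigh hlow n ht ξ
          have h2 : 0 ≤ ((∑ j ∈ Finset.range n, S j) + Q) ξ := by
            rw [Pi.add_apply, Finset.sum_apply]
            exact add_nonneg (Finset.sum_nonneg fun j _ => by positivity) (by positivity)
          rw [Real.norm_of_nonneg (le_max_right _ _)]
          refine max_le ?_ h2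
          rw [Pi.add_apply, Finset.sum_apply]
          simp only [hS, hr, hQ, ← mul_div_assoc] at h1 ⊢
          linarith
      _ ≤ (∑ j ∈ Finset.range n, eLpNorm (S j) 2 μ) + eLpNorm Q 2 μ := by
          refine (eLpNorm_add_le ?_ hQc.aestronglyMeasurable one_le_two).trans ?_
          · exact Finset.aestronglyMeasurable_sum _ fun j _ => (hSc j).aestronglyMeasurable
          · gcongr
            exact eLpNorm_sum_le (fun j _ => (hSc j).aestronglyMeasurable) one_le_two
      _ ≤ ENNReal.ofReal (Real.exp (-σ * t)) * eLpNorm (W 0) 2 μ + eLpNorm Q 2 μ := by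
          gcongr
          refine (Finset.sum_le_sum fun j _ => hSn j).trans ?_
          rw [← Finset.sum_mul, ← ENNReal.ofReal_sum_of_nonneg fun j _ => by positivity,
            ← Finset.mul_sum]
          gcongr
          calc _ ≤ Real.exp (-(9 / 8) * t) * Real.exp (δ * L * t) := by
                gcongr
                exact Real.sum_le_exp_of_nonneg (by positivity) n
            _ = Real.exp (-(9 / 8) * t + δ * L * t) := by rw [Real.exp_add]
            _ ≤ _ := by
                apply Real.exp_le_exp.2
                have : δ * L ≤ 1 / 4 := (mul_le_mul_of_nonneg_left hLp hδ).trans hδp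
                nlinarith
      _ = _ := by rw [hQn]; ring
  have hlim : ∀ᵐ ξ ∂μ, Tendsto (fun n => max (‖W t ξ‖ - r n) 0) atTop (𝓝 ‖W t ξ‖) := by
    refine ae_of_all _ fun ξ => ?_
    have h1 := (FloorSemiring.tendsto_pow_div_factorial_atTop (δ * t)).const_mul K
    have h2 := ((tendsto_const_nhds (x := ‖W t ξ‖)).sub h1).max (tendsto_const_nhds (x := (0 : ℝ)))
    simpa using h2
  rw [← eLpNorm_norm]
  refine (Lp.eLpNorm_lim_le_liminf_eLpNorm (fun n => ?_) _ hlim).trans ?_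
  · exact Continuous.aestronglyMeasurable (by fun_prop)
  · refine (liminf_le_liminf (Eventually.of_forall hbound)).trans_eq ?_
    simp

/-- An integrable function is in `H^l` as soon as its Sobolev norm is finite. -/
lemma memSobolev_of_sobolevNorm {l : ℝ} (hl : 0 ≤ l) {f : ℝ → ℝ} (hf : Integrable f)
    (h : sobolevNorm l f < ⊤) : MemSobolev l f := by
  refine ⟨memLp_two_of_fourier hf ⟨(continuous_fourier hf).aestronglyMeasurable, ?_⟩, h⟩
  rw [sobolevNorm_eq hf] at h
  refine lt_of_le_of_lt (eLpNorm_mono_measure _ ?_) h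
  rw [sobolevMeasure]
  nth_rewrite 1 [← withDensity_one (μ := (volume : Measure ℝ))]
  refine withDensity_mono (ae_of_all _ fun ξ => ?_)
  rw [Pi.one_apply, ENNReal.one_le_ofReal]
  exact Real.one_le_rpow (by nlinarith [sq_nonneg |ξ|]) hl

lemma sobolevNorm_H_lt_top (l : ℝ) : sobolevNorm l H < ⊤ := by
  obtain ⟨p, hp⟩ := exists_nat_ge (l + 1)
  rw [sobolevNorm_eq integrable_H]
  refine lt_of_le_of_lt (eLpNorm_le_mul_eLpNorm_of_ae_le_mul
    (c := Real.exp 1 * (2 * p + 1).factorial) (ae_of_all _ fun ξ => ?_) 2)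
    (ENNReal.mul_lt_top ENNReal.ofReal_lt_top (eLpNorm_barrier_lt_top hp))
  · rw [fourier_H, Complex.norm_real, Real.norm_of_nonneg (steady_pos ξ).le,
      Real.norm_of_nonneg (by positivity)]
    exact steady_le p ξ

lemma integrable_weight_sq_mul_H : Integrable (fun x : ℝ => (1 + |x|) ^ 2 * H x) := by
  refine (integrable_sq_mul_H.const_mul 2).mono'
    (Continuous.aestronglyMeasurable (by have := continuous_H; fun_prop)) (ae_of_all _ fun x => ?_)
  rw [Real.norm_of_nonneg (mul_nonneg (by positivity) (H_nonneg x)), ← mul_assoc]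
  refine mul_le_mul_of_nonneg_right ?_ (H_nonneg x)
  nlinarith [sq_nonneg (1 - |x|), sq_abs x]

/-- The initial Fourier distance of order `κ` is controlled by the weighted `L¹` distance. -/
lemma norm_fourier_sub_H_le {f : ℝ → ℝ} (hf0 : Integrable f)
    (hf : Integrable (fun x : ℝ => (1 + |x|) ^ 2 * f x)) (hn : IsNormalised f) {κ k : ℝ}
    (hκ : 2 ≤ κ) (hκ' : κ ≤ 3) (hk : κ ≤ k)
    (h : weightedL1Norm k (fun x => f x - H x) ≠ ⊤) (ξ : ℝ) :
    ‖fourier f ξ - steady ξ‖ ≤ 4 * (weightedL1Norm k (fun x => f x - H x)).toReal * |ξ| ^ κ := by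
  have b1 : ∀ x : ℝ, |x| ≤ (1 + |x|) ^ 2 := fun x => by nlinarith [abs_nonneg x]
  have b2 : ∀ x : ℝ, |x ^ 2| ≤ (1 + |x|) ^ 2 := fun x => by
    rw [abs_pow]; nlinarith [abs_nonneg x]
  have hfH : Integrable (fun x => f x - H x) := hf0.sub integrable_H
  rw [← fourier_H, ← fourier_sub hf0 integrable_H]
  refine norm_fourier_le_of_moments hκ hκ' hk ?_ hfH ?_ ?_ ?_ h ξ
  · simp only [mul_sub]
    exact hf.sub integrable_weight_sq_mul_H
  · rw [integral_sub hf0 integrable_H, hn.1, integral_H, sub_self]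
  · simp only [mul_sub]
    rw [integral_sub (integrable_mul_of_weight_sq (p := fun x => x) hf0 hf continuous_id b1)
      (integrable_mul_of_weight_sq (p := fun x => x) integrable_H integrable_weight_sq_mul_H
        continuous_id b1),
      hn.2.1, integral_mul_H, sub_self]
  · simp only [mul_sub]
    rw [integral_sub (integrable_mul_of_weight_sq hf0 hf (continuous_pow 2) b2)
      (integrable_mul_of_weight_sq integrable_H integrable_weight_sq_mul_H (continuous_pow 2) b2),
      hn.2.2, integral_sq_mul_H, sub_self]

end Boltzmann1D

open Boltzmann1D in
theorem theorem1p3 (l k σ β c : ℝ) (hl : 0 ≤ l) (hk : 5 / 2 < k) (hk' : k < 3)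
    (hσ : 0 < σ) (hσ' : σ < 9 / 8 - k / 4 - (2 : ℝ) ^ (3 / 2 - k)) (hβ : 0 < β) (hc : 0 < c) :
    ∃ C : ℝ, 0 < C ∧
      ∀ g : ℝ → ℝ → ℝ, Boltzmann1D.IsSolution g → Boltzmann1D.IsNormalised (g 0) →
        (∀ ξ : ℝ, ‖Boltzmann1D.fourier (g 0) ξ‖ ≤ (1 + c ^ 2 * |ξ| ^ 2) ^ (-(β / 2))) →
        Boltzmann1D.MemSobolev l (g 0) →
        ∀ t : ℝ, 0 ≤ t →
          Boltzmann1D.MemSobolev l (g t) ∧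
          Boltzmann1D.sobolevNorm l (fun x => g t x - Boltzmann1D.H x) ≤
            ENNReal.ofReal (Real.exp (-σ * t)) *
              (Boltzmann1D.sobolevNorm l (fun x => g 0 x - Boltzmann1D.H x)
                + ENNReal.ofReal C *
                  Boltzmann1D.weightedL1Norm k (fun x => g 0 x - Boltzmann1D.H x)) := by
  have hσ2 : σ ≤ 1 / 2 := by
    have : (0 : ℝ) < 2 ^ (3 / 2 - k) := by positivity
    linarith
  obtain ⟨p, hp⟩ := exists_nat_ge (l + 1)
  set δ : ℝ := 1 / (4 * 4 ^ p) with hδ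
  have hδ0 : 0 < δ := by positivity
  have hδp : δ * 4 ^ p ≤ 1 / 4 := le_of_eq (by rw [hδ]; field_simp)
  obtain ⟨R, hR0, hR⟩ := exists_uniform_smallness hβ hc hδ0
  -- in the `L²` norm with weight `|ξ|^{-2k}` the rate is that of the Fourier distance of order `κ`
  set κ : ℝ := k - 1 / 2 with hκ
  have hrate : 1 - κ / 4 - (2 : ℝ) ^ (1 - κ) = 9 / 8 - k / 4 - (2 : ℝ) ^ (3 / 2 - k) := by
    rw [hκ, show 1 - (k - 1 / 2) = 3 / 2 - k by ring]; ring
  set b := (eLpNorm (fun ξ : ℝ => ((1 + ξ ^ 2) ^ p)⁻¹) 2 (sobolevMeasure l)).toReal with hb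
  have hbE : eLpNorm (fun ξ : ℝ => ((1 + ξ ^ 2) ^ p)⁻¹) 2 (sobolevMeasure l) = ENNReal.ofReal b :=
    (ENNReal.ofReal_toReal (eLpNorm_barrier_lt_top hp).ne).symm
  have hb0 : 0 ≤ b := ENNReal.toReal_nonneg
  set C0 : ℝ := 4 * (8 * R ^ κ) * (1 + 4 * R ^ 2) ^ p * b with hC0
  have hC00 : 0 ≤ C0 := by positivity
  refine ⟨C0 + 1, by positivity, fun g hg hn hF hm t ht => ?_⟩
  have h0 := hn.1
  set W : ℝ → ℝ → ℂ := fun t ξ => fourier (g t) ξ - steady ξ with hW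
  set N : ℝ → ℝ → ℂ := fun t ξ => fourier (g t) ξ ^ 2 - (steady ξ : ℂ) ^ 2 with hN
  have hWN : IsTransported W N := (hg.isTransported h0).sub isTransported_steady
  have hs : ∀ ξ, ‖(steady ξ : ℂ)‖ = steady ξ := fun ξ => by
    rw [Complex.norm_real, Real.norm_of_nonneg (steady_pos ξ).le]
  have hWeq : ∀ t, 0 ≤ t → fourier (fun x => g t x - H x) = W t := fun t ht => by
    ext ξ
    rw [fourier_sub (hg.integrable ht) integrable_H, fourier_H]
  have hgH : ∀ t, 0 ≤ t → Integrable (fun x => g t x - H x) := fun t ht =>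
    (hg.integrable ht).sub integrable_H
  have hWc : ∀ t, 0 ≤ t → Continuous (W t) := fun t ht => by
    rw [← hWeq t ht]
    exact continuous_fourier (hgH t ht)
  have hK : ∀ t ξ, 0 ≤ t → ‖W t ξ‖ ≤ 2 := fun t ξ ht => by
    refine (norm_sub_le _ _).trans ?_
    rw [hs]
    linarith [hg.norm_fourier_le_one h0 ht ξ, steady_le_one ξ]
  have hNW : ∀ t ξ, ‖N t ξ‖ ≤ (‖fourier (g t) ξ‖ + steady ξ) * ‖W t ξ‖ := fun t ξ => by
    have : N t ξ = (fourier (g t) ξ + steady ξ) * W t ξ := by simp only [hN, hW]; ring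
    rw [this, norm_mul]
    gcongr
    exact (norm_add_le _ _).trans_eq (by rw [hs])
  have hN2 : ∀ t ξ, 0 ≤ t → ‖N t ξ‖ ≤ 2 * ‖W t ξ‖ := fun t ξ ht => by
    refine (hNW t ξ).trans ?_
    gcongr
    linarith [hg.norm_fourier_le_one h0 ht ξ, steady_le_one ξ]
  have hhigh : ∀ t ξ, 0 ≤ t → R < |ξ| → ‖N t ξ‖ ≤ δ * ‖W t ξ‖ := fun t ξ ht hξ => by
    refine (hNW t ξ).trans ?_
    gcongr
    exact hR g hg h0 hF t ξ ht hξ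
  have hnorm : ∀ t, 0 ≤ t →
      sobolevNorm l (fun x => g t x - H x) = eLpNorm (W t) 2 (sobolevMeasure l) := fun t ht => by
    rw [sobolevNorm_eq (hgH t ht), hWeq t ht]
  refine ⟨?_, ?_⟩
  · have hfin0 : eLpNorm (W 0) 2 (sobolevMeasure l) < ⊤ := by
      have hmH : eLpNorm (fourier H) 2 (sobolevMeasure l) < ⊤ := by
        rw [← sobolevNorm_eq integrable_H]; exact sobolevNorm_H_lt_top l
      have hmg : eLpNorm (fourier (g 0)) 2 (sobolevMeasure l) < ⊤ := by
        rw [← sobolevNorm_eq (hg.integrable le_rfl)]; exact hm.2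
      have h1 : W 0 = fourier (g 0) - fourier H := by
        ext ξ; simp [hW, fourier_H]
      rw [h1]
      exact (eLpNorm_sub_le (continuous_fourier (hg.integrable le_rfl)).aestronglyMeasurable
        (continuous_fourier integrable_H).aestronglyMeasurable one_le_two).trans_lt
        (ENNReal.add_lt_top.2 ⟨hmg, hmH⟩)
    -- for the bare membership the crude low-frequency bound `‖N‖ ≤ 4` is enough
    have hbd := hWN.eLpNorm_le hWc hK (D := 4) (R := R) (σ := 0) hl hδ0.le (by norm_num) hp hδp
      (by norm_num) hhigh (fun t ξ ht _ => by
        simp only [neg_zero, zero_mul, Real.exp_zero, mul_one]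
        linarith [hN2 t ξ ht, hK t ξ ht]) ht
    have hfin : eLpNorm (W t) 2 (sobolevMeasure l) < ⊤ := by
      refine hbd.trans_lt (ENNReal.mul_lt_top ENNReal.ofReal_lt_top (ENNReal.add_lt_top.2
        ⟨hfin0, ENNReal.mul_lt_top ENNReal.ofReal_lt_top (eLpNorm_barrier_lt_top hp)⟩))
    refine memSobolev_of_sobolevNorm hl (hg.integrable ht) ?_
    have hmH : eLpNorm (fourier H) 2 (sobolevMeasure l) < ⊤ := by
      rw [← sobolevNorm_eq integrable_H]; exact sobolevNorm_H_lt_top l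
    have h1 : fourier (g t) = W t + fourier H := by
      ext ξ; simp [hW, fourier_H]
    rw [sobolevNorm_eq (hg.integrable ht), h1]
    exact (eLpNorm_add_le (hWc t ht).aestronglyMeasurable
      (continuous_fourier integrable_H).aestronglyMeasurable one_le_two).trans_lt
      (ENNReal.add_lt_top.2 ⟨hfin, hmH⟩)
  · by_cases hM : weightedL1Norm k (fun x => g 0 x - H x) = ⊤
    · -- the right-hand side is infinite because `C0 + 1` is positive
      have h1 : ENNReal.ofReal (C0 + 1) ≠ 0 := by
        rw [Ne, ENNReal.ofReal_eq_zero]; linarith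
      have h2 : ENNReal.ofReal (Real.exp (-σ * t)) ≠ 0 := by
        rw [Ne, ENNReal.ofReal_eq_zero, not_le]; exact Real.exp_pos _
      rw [hM, ENNReal.mul_top h1, add_top, ENNReal.mul_top h2]
      exact le_top
    set M := (weightedL1Norm k (fun x => g 0 x - H x)).toReal with hMdef
    have hM0 : 0 ≤ M := ENNReal.toReal_nonneg
    have hdec : ∀ t ξ, 0 ≤ t → ‖W t ξ‖ ≤ 4 * M * |ξ| ^ κ * Real.exp (-σ * t) := fun t ξ ht => by
      have h1 := hWN.norm_le_rpow hK hN2 (κ := κ) (M := 4 * M) (by positivity)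
        (norm_fourier_sub_H_le (hg.integrable le_rfl) (hg.moments 0 le_rfl) hn (by linarith)
          (by linarith) (by linarith) hM) ht ξ
      rw [hrate] at h1
      refine h1.trans ?_
      gcongr
    have hbd := hWN.eLpNorm_le hWc hK (D := 8 * R ^ κ * M) (R := R) (σ := σ) hl hδ0.le
      (by positivity) hp hδp hσ2 hhigh (fun t ξ ht hξ => by
        have h1 : |ξ| ^ κ ≤ R ^ κ := by gcongr; linarith
        calc ‖N t ξ‖ ≤ 2 * (4 * M * |ξ| ^ κ * Real.exp (-σ * t)) :=
              (hN2 t ξ ht).trans (by gcongr; exact hdec t ξ ht)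
          _ ≤ 2 * (4 * M * R ^ κ * Real.exp (-σ * t)) := by gcongr
          _ = _ := by ring) ht
    rw [hnorm t ht, hnorm 0 le_rfl]
    refine hbd.trans ?_
    rw [hbE, ← ENNReal.ofReal_mul (by positivity), ← ENNReal.ofReal_toReal hM,
      ← ENNReal.ofReal_mul (by positivity), ← hMdef]
    refine mul_le_mul_right (add_le_add_right (ENNReal.ofReal_le_ofReal ?_) _) _
    calc _ = C0 * M := by rw [hC0]; ring
      _ ≤ _ := by gcongr; linarith
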